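/- \textbf{Setting.} Let $\mathcal P=\{1,\dots,N\}$ be a finite set of modes, $(\Omega,\mathfrak F,\mathsf P)$ a probability space, and consider the control-affine switched system $$\dot x=f_\sigma(x)+\sum_{j=1}^m g_{\sigma,j}(x)\,u_j,\qquad x(0)=x_0\in\mathbb R^n,\ \sigma(0)=\sigma_0\in\mathcal P,\ t\ge 0,\ u\in\mathbb R^m,$$ where $f_i,g_{i,j}:\mathbb R^n\to\mathbb R^n$ are twice continuously differentiable with $f_i(0)=0$, $g_{i,j}(0)=0$, and $\sigma=(\sigma(t))_{t\ge0}$ is a càdlàg $\mathcal P$-valued process with deterministic initial value $\sigma_0$. Write $L_fV(x)=\langle\nabla V(x),f(x)\rangle$ and let $\|\cdot\|$ be the Euclidean norm. \textbf{Class EH.} $\sigma$ is of class EH with parameters $\lambda>0$ and $q_i\in[0,1]$, $i\in\mathcal P$, if there are random switching instants $(\tau_j)_{j\ge0}$ with, almost surely, $0=\tau_0<\tau_1<\tau_2<\cdots$ and $\sigma$ constant on each $[\tau_j,\tau_{j+1})$ (consecutive modes $\sigma(\tau_j),\sigma(\tau_{j+1})$ may coincide), such that: the holding times $S_i=\tau_i-\tau_{i-1}$,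 $i\ge1$, are i.i.d. exponential with parameter $\lambda$; $\mathsf P\big(\sigma(\tau_j)=i\,\big|\,\sigma(\tau_0),\dots,\sigma(\tau_{j-1})\big)=q_i$ almost surely for all $j\ge1$, $i\in\mathcal P$; and the sequences $(S_i)_{i\ge1}$ and $(\sigma(\tau_j))_{j\ge0}$ are independent. \textbf{GAS almost surely.} A switched system $\dot x=F_\sigma(x)$ is globally asymptotically stable almost surely if, almost surely, (AS1) for every $\varepsilon>0$ there is $\delta>0$ such that every solution with $\|x_0\|<\delta$ satisfies $\sup_{t\ge0}\|x(t)\|<\varepsilon$; and (AS2) for all $r,\varepsilon'>0$ there is $T\ge0$ such that every solution with $\|x_0\|<r$ satisfies $\sup_{t\ge T}\|x(t)\|<\varepsilon'$. Solutions are understood in the sense of Carathéodory; $\delta$ and $T$ may depend on the sample point, but not on $x_0$. \textbf{Theorem.} Let $\sigma$ be of class EH with parameters $\lambda,(q_i)$. Suppose there are twice continuously differentiable $V_i:\mathbb R^n\to\mathbb R$, $i\in\mathcal P$, continuous strictly increasing unbounded functions $\alpha_1,\alpha_2:[0,\infty)\to[0,\infty)$ with $\alpha_1(0)=\alpha_2(0)=0$,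 and numbers $\mu>1$ and $\lambda_i\in\mathbb R$, $i\in\mathcal P$, such that \begin{enumerate} \item (V1) $\alpha_1(\|x\|)\le V_i(x)\le\alpha_2(\|x\|)$ for all $x\in\mathbb R^n$, $i\in\mathcal P$; \item (V3) $V_i(x)\le\mu V_j(x)$ for all $x\in\mathbb R^n$, $i,j\in\mathcal P$; \item (control-Lyapunov inequality) for all $x\ne0$ and $i\in\mathcal P$, $$\inf_{u\in\mathbb R^m}\Big\{L_{f_i}V_i(x)+\lambda_iV_i(x)+\sum_{j=1}^m u_jL_{g_{i,j}}V_i(x)\Big\}<0;$$ \item (small-control property) for every $\varepsilon>0$ there is $\delta>0$ such that for every $x\neq0$ with $\|x\|<\delta$ there is $u\in\mathbb R^m$ with $\|u\|<\varepsilon$ and $L_{f_i}V_i(x)+\sum_{j=1}^m u_jL_{g_{i,j}}V_i(x)\le-\lambda_iV_i(x)$ for all $i\in\mathcal P$; \item (E3) $\lambda_i+\lambda>0$ for all $i\in\mathcal P$, and (E4) $\displaystyle\sum_{i\in\mathcal P}\frac{\mu q_i}{1+\lambda_i/\lambda}<1$. \end{enumerate} Define $$k_{i,j}(x)=-L_{g_{i,j}}V_i(x)\;\varphi\Big(L_{f_i}V_i(x)+\lambda_iV_i(x),\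 \sum_{l=1}^m\big(L_{g_{i,l}}V_i(x)\big)^2\Big),\qquad \varphi(a,b)=\begin{cases}\dfrac{a+\sqrt{a^2+b^2}}{b}&b\ne0,\\[1ex]0&b=0.\end{cases}$$ Then the closed-loop system $\dot x=f_\sigma(x)+\sum_{j=1}^m g_{\sigma,j}(x)k_{\sigma,j}(x)$ is well posed, i.e. almost surely, for every $x_0\in\mathbb R^n$ it has a solution on $[0,\infty)$ and every solution on an interval $[0,T]$ coincides with it there, and it is globally asymptotically stable almost surely. -/

import Mathlib

open MeasureTheory ProbabilityTheory Filter Topology Set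
open scoped NNReal ENNReal

noncomputable section

namespace RandomSwitching

/-- Class `𝒦`: continuous, strictly increasing functions `[0,∞) → [0,∞)` vanishing at `0`. -/
structure IsClassK (α : ℝ≥0 → ℝ≥0) : Prop where
  continuous : Continuous α
  strictMono : StrictMono α
  map_zero : α 0 = 0

/-- Class `𝒦∞`: class `𝒦` functions that are unbounded. -/
structure IsClassKInfty (α : ℝ≥0 → ℝ≥0) : Prop extends IsClassK α where
  tendsto_atTop : Tendsto α atTop atTop

/-- The Lie derivative `L_f V (x) = ⟨∇V(x), f(x)⟩`. -/
def lieD {n : ℕ} (f : EuclideanSpace ℝ (Fin n) → EuclideanSpace ℝ (Fin n))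
    (V : EuclideanSpace ℝ (Fin n) → ℝ) (x : EuclideanSpace ℝ (Fin n)) : ℝ :=
  inner ℝ (gradient V x) (f x)

/-- A switching signal: a càdlàg process `(σ(t))_{t ≥ 0}` with values in the finite (discrete) set
of modes, started at the deterministic mode `σ₀`. Only times `t ≥ 0` matter. -/
structure IsSwitchingSignal {Ω : Type*} [MeasurableSpace Ω] {N : ℕ}
    (σ : ℝ → Ω → Fin N) (σ₀ : Fin N) : Prop where
  measurable : ∀ t, 0 ≤ t → Measurable (σ t)
  right_continuous : ∀ ω t, 0 ≤ t → ContinuousWithinAt (fun s => σ s ω) (Ici t) t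
  left_limits : ∀ ω t, 0 < t → ∃ i, Tendsto (fun s => σ s ω) (𝓝[<] t) (𝓝 i)
  initial : ∀ ω, σ 0 ω = σ₀

/-- `τ 0 = 0 < τ 1 < τ 2 < …` are switching instants of `σ`: almost surely `σ` keeps the value
`σ(τ j)` on `[τ j, τ (j+1))`. The mode selected at a switching instant may coincide with the
preceding one. -/
structure IsSwitchingInstants {Ω : Type*} [MeasurableSpace Ω] (P : Measure Ω) {N : ℕ}
    (σ : ℝ → Ω → Fin N) (τ : ℕ → Ω → ℝ) : Prop where
  measurable : ∀ j, Measurable (τ j)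
  measurable_mode : ∀ j, Measurable fun ω => σ (τ j ω) ω
  zero : ∀ ω, τ 0 ω = 0
  strictMono : ∀ᵐ ω ∂P, StrictMono fun j => τ j ω
  const : ∀ᵐ ω ∂P, ∀ j, ∀ t ∈ Ico (τ j ω) (τ (j + 1) ω), σ t ω = σ (τ j ω) ω

/-- The holding times; `holdingTime τ i` is `S_{i+1} = τ_{i+1} - τ_i`. -/
def holdingTime {Ω : Type*} (τ : ℕ → Ω → ℝ) (i : ℕ) (ω : Ω) : ℝ := τ (i + 1) ω - τ i ω

/-- Class EH, with exponential parameter `lam` and mode probabilities `q`. -/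
def IsClassEH {Ω : Type*} [MeasurableSpace Ω] (P : Measure Ω) {N : ℕ}
    (σ : ℝ → Ω → Fin N) (lam : ℝ) (q : Fin N → ℝ) : Prop :=
  ∃ τ : ℕ → Ω → ℝ, IsSwitchingInstants P σ τ ∧
    -- the holding times are i.i.d. exponential
    (0 < lam ∧ iIndepFun (holdingTime τ) P ∧ ∀ i, P.map (holdingTime τ i) = expMeasure lam) ∧
    -- the selected modes are memoryless: `P(σ(τ_j) = i | σ(τ_0), …, σ(τ_{j-1})) = q_i` for `j ≥ 1`
    ((∀ i, q i ∈ Icc (0 : ℝ) 1) ∧ ∀ j, 1 ≤ j → ∀ i,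
      P[{ω | σ (τ j ω) ω = i}.indicator (fun _ => (1 : ℝ)) |
        ⨆ k : Fin j, MeasurableSpace.comap (fun ω => σ (τ k ω) ω) inferInstance]
        =ᵐ[P] fun _ => q i) ∧
    -- the holding times and the selected modes are mutually independent sequences
    IndepFun (fun ω i => holdingTime τ i ω) (fun ω j => σ (τ j ω) ω) P

/-- `x` is a Carathéodory solution on `[0, T]` of `ẋ(t) = F_{s(t)}(x(t))`, `x(0) = x₀`
(integral form: `x` is absolutely continuous and solves the equation almost everywhere). -/
def IsSolutionOn {n N : ℕ} (F : Fin N → EuclideanSpace ℝ (Fin n) → EuclideanSpace ℝ (Fin n))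
    (s : ℝ → Fin N) (x₀ : EuclideanSpace ℝ (Fin n)) (T : ℝ)
    (x : ℝ → EuclideanSpace ℝ (Fin n)) : Prop :=
  ContinuousOn x (Icc 0 T) ∧
    IntervalIntegrable (fun r => F (s r) (x r)) volume 0 T ∧
    ∀ t ∈ Icc 0 T, x t = x₀ + ∫ r in (0 : ℝ)..t, F (s r) (x r)

/-- A solution on `[0, ∞)`. -/
def IsGlobalSolution {n N : ℕ} (F : Fin N → EuclideanSpace ℝ (Fin n) → EuclideanSpace ℝ (Fin n))
    (s : ℝ → Fin N) (x₀ : EuclideanSpace ℝ (Fin n)) (x : ℝ → EuclideanSpace ℝ (Fin n)) : Prop :=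
  ∀ T, 0 ≤ T → IsSolutionOn F s x₀ T x

/-- Almost surely, from every initial state there is a global solution, and every solution on an
interval `[0, T]` coincides with it there. -/
def IsWellPosed {Ω : Type*} [MeasurableSpace Ω] (P : Measure Ω) {n N : ℕ}
    (F : Fin N → EuclideanSpace ℝ (Fin n) → EuclideanSpace ℝ (Fin n))
    (σ : ℝ → Ω → Fin N) : Prop :=
  ∀ᵐ ω ∂P, ∀ x₀, ∃ x, IsGlobalSolution F (fun t => σ t ω) x₀ x ∧
    ∀ T, 0 ≤ T → ∀ y, IsSolutionOn F (fun t => σ t ω) x₀ T y → EqOn y x (Icc 0 T)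

/-- Global asymptotic stability almost surely of `ẋ = F_σ(x)`. The suprema are taken in `[0, ∞]`. -/
structure IsGASas {Ω : Type*} [MeasurableSpace Ω] (P : Measure Ω) {n N : ℕ}
    (F : Fin N → EuclideanSpace ℝ (Fin n) → EuclideanSpace ℝ (Fin n))
    (σ : ℝ → Ω → Fin N) : Prop where
  stable : ∀ᵐ ω ∂P, ∀ ε : ℝ, 0 < ε → ∃ δ : ℝ, 0 < δ ∧ ∀ x₀ x,
    IsGlobalSolution F (fun t => σ t ω) x₀ x → ‖x₀‖ < δ →
      ⨆ t ∈ Ici (0 : ℝ), ‖x t‖ₑ < ENNReal.ofReal ε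
  attractive : ∀ᵐ ω ∂P, ∀ r ε : ℝ, 0 < r → 0 < ε → ∃ T : ℝ, 0 ≤ T ∧ ∀ x₀ x,
    IsGlobalSolution F (fun t => σ t ω) x₀ x → ‖x₀‖ < r →
      ⨆ t ∈ Ici T, ‖x t‖ₑ < ENNReal.ofReal ε

/-- The function `φ` of the universal formula. -/
def phi (a b : ℝ) : ℝ := if b ≠ 0 then (a + √(a ^ 2 + b ^ 2)) / b else 0

/-- The mode-dependent universal feedback `k_{i,j}(x)`, where `rate i` is `λ_i`. -/
def universalFeedback {n N m : ℕ}
    (f : Fin N → EuclideanSpace ℝ (Fin n) → EuclideanSpace ℝ (Fin n))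
    (g : Fin N → Fin m → EuclideanSpace ℝ (Fin n) → EuclideanSpace ℝ (Fin n))
    (V : Fin N → EuclideanSpace ℝ (Fin n) → ℝ) (rate : Fin N → ℝ)
    (i : Fin N) (j : Fin m) (x : EuclideanSpace ℝ (Fin n)) : ℝ :=
  -lieD (g i j) (V i) x *
    phi (lieD (f i) (V i) x + rate i * V i x) (∑ l, (lieD (g i l) (V i) x) ^ 2)

/-- The closed-loop vector fields `f_i(x) + ∑_j k_{i,j}(x) g_{i,j}(x)`. -/
def closedLoop {n N m : ℕ}
    (f : Fin N → EuclideanSpace ℝ (Fin n) → EuclideanSpace ℝ (Fin n))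
    (g : Fin N → Fin m → EuclideanSpace ℝ (Fin n) → EuclideanSpace ℝ (Fin n))
    (k : Fin N → Fin m → EuclideanSpace ℝ (Fin n) → ℝ)
    (i : Fin N) (x : EuclideanSpace ℝ (Fin n)) : EuclideanSpace ℝ (Fin n) :=
  f i x + ∑ j, k i j x • g i j x

end RandomSwitching

end

/-! While mode i is active, the closed loop makes V_i decay at rate λ_i (of either sign), and by
(V3) each switching instant costs at most a factor μ. Solutions are therefore controlled by the path
functional Z_j = ∏_{k<j} μ exp(-λ_{σ(τ_k)} S_{k+1}) (`growthFactor`), which does not involve x₀.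
Independence makes E Z_{j+1} geometric in j, with ratio the sum in (E4); so ∑ E Z_j is finite and
Z_j → 0 almost surely (`IsSwitchingInstants.ae_tendsto_growthFactor`). On such a path boundedness of
Z gives (AS1) and smallness of its tail gives (AS2), uniformly in x₀, through the bounds (V1)
(`IsSwitchingSequence.classK_le`).

Well-posedness needs care because the closed-loop field is known to be C¹ only off the origin. The
small-control property keeps the feedback bounded near 0, and g_{i,j}(0) = 0 turns this into linear
growth ‖F(x)‖ ≤ C‖x‖ on balls. Hence a nonzero trajectory cannot reach 0 in finite time, while the
Lyapunov function excludes blow-up. On a bounded time interval it stays in an annulus, where F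
coincides with a globally Lipschitz cutoff, so the classical existence and uniqueness theorems apply
(`IsDampedField`). Pieces over successive holding intervals cover [0,∞) because τ_j → ∞ almost
surely. -/

namespace RandomSwitching

/-! ### The scalar function φ of the universal formula. -/

section UniversalFormula

lemma phi_mul_self {a b : ℝ} (hb : b ≠ 0) : phi a b * b = a + √(a ^ 2 + b ^ 2) := by
  rw [phi, if_pos hb, div_mul_cancel₀ _ hb]

lemma phi_nonneg {a b : ℝ} (hb : 0 ≤ b) : 0 ≤ phi a b := by
  unfold phi
  split_ifs
  · refine div_nonneg ?_ hb
    have : |a| ≤ √(a ^ 2 + b ^ 2) := Real.abs_le_sqrt (by nlinarith [sq_nonneg b])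
    linarith [neg_abs_le a]
  · exact le_rfl

/-- Since √(a² + b²) ≤ |a| + b, the product is at most b when a ≤ 0 and 2a + b when a ≥ 0. It is
used with c = ‖u‖√b, the bound on a supplied by an admissible control u. -/
lemma phi_mul_le {a b c : ℝ} (hb : 0 ≤ b) (hac : a ≤ c) (hc : 0 ≤ c) :
    phi a b * b ≤ 2 * c + b := by
  rcases hb.eq_or_lt with rfl | hb'
  · simpa using hc
  rw [phi_mul_self hb'.ne']
  rcases le_total a 0 with ha | ha
  · have : √(a ^ 2 + b ^ 2) ≤ -a + b := by
      rw [Real.sqrt_le_left (by linarith)]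
      nlinarith
    linarith
  · have : √(a ^ 2 + b ^ 2) ≤ a + b := by
      rw [Real.sqrt_le_left (by linarith)]
      nlinarith
    linarith

/-- The universal formula is smooth where `b ≠ 0` or `a < 0`. -/
lemma contDiffAt_phi {a b : ℝ} (h : b ≠ 0 ∨ a < 0) :
    ContDiffAt ℝ 1 (fun p : ℝ × ℝ => phi p.1 p.2) (a, b) := by
  have hpos : a ^ 2 + b ^ 2 ≠ 0 := by
    rcases h with h | h
    · have := sq_nonneg a; positivity
    · have := h.ne; positivity
  have hsqrt : ContDiffAt ℝ 1 (fun p : ℝ × ℝ => √(p.1 ^ 2 + p.2 ^ 2)) (a, b) :=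
    ContDiffAt.sqrt (by fun_prop) hpos
  rcases ne_or_eq b 0 with hb | rfl
  · have h1 : ContDiffAt ℝ 1 (fun p : ℝ × ℝ => (p.1 + √(p.1 ^ 2 + p.2 ^ 2)) / p.2) (a, b) :=
      (contDiffAt_fst.add hsqrt).div contDiffAt_snd hb
    refine h1.congr_of_eventuallyEq ?_
    filter_upwards [continuousAt_snd.eventually_ne (show (a, b).2 ≠ 0 from hb)] with p hp
    rw [phi, if_pos hp]
  · have ha : a < 0 := by simpa using h
    -- Multiplying by the conjugate gives φ = b / (√(a² + b²) - a), which is regular at b = 0 when a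
    -- < 0 and agrees there with the default value 0.
    have h1 : ContDiffAt ℝ 1 (fun p : ℝ × ℝ => p.2 / (√(p.1 ^ 2 + p.2 ^ 2) - p.1)) (a, 0) := by
      refine contDiffAt_snd.div (hsqrt.sub contDiffAt_fst) ?_
      have := Real.sqrt_nonneg (a ^ 2 + 0 ^ 2)
      simp only
      linarith
    refine h1.congr_of_eventuallyEq ?_
    filter_upwards [continuousAt_fst.eventually_lt continuousAt_const
      (show (a, (0 : ℝ)).1 < 0 from ha)] with p hp
    have hden : √(p.1 ^ 2 + p.2 ^ 2) - p.1 ≠ 0 := by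
      have := Real.sqrt_nonneg (p.1 ^ 2 + p.2 ^ 2)
      linarith
    unfold phi
    split_ifs with h0
    · rw [div_eq_div_iff h0 hden]
      have := Real.sq_sqrt (show 0 ≤ p.1 ^ 2 + p.2 ^ 2 by positivity)
      linear_combination this
    · simp [not_not.1 h0]

end UniversalFormula

/-! ### Regularity, decay and growth of the closed-loop fields. -/

section VectorField

variable {n N m : ℕ} {f : Fin N → EuclideanSpace ℝ (Fin n) → EuclideanSpace ℝ (Fin n)}
  {g : Fin N → Fin m → EuclideanSpace ℝ (Fin n) → EuclideanSpace ℝ (Fin n)}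
  {V : Fin N → EuclideanSpace ℝ (Fin n) → ℝ} {rate : Fin N → ℝ} {i : Fin N}

lemma lieD_eq_fderiv {W : EuclideanSpace ℝ (Fin n) → ℝ}
    (F : EuclideanSpace ℝ (Fin n) → EuclideanSpace ℝ (Fin n)) (x : EuclideanSpace ℝ (Fin n)) :
    lieD F W x = fderiv ℝ W x (F x) := by
  rw [lieD, gradient, InnerProductSpace.toDual_symm_apply]

lemma contDiff_lieD {W : EuclideanSpace ℝ (Fin n) → ℝ} (hW : ContDiff ℝ 2 W)
    {F : EuclideanSpace ℝ (Fin n) → EuclideanSpace ℝ (Fin n)} (hF : ContDiff ℝ 1 F) :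
    ContDiff ℝ 1 (lieD F W) := by
  rw [funext (lieD_eq_fderiv F)]
  exact (hW.fderiv_right (m := 1) (by norm_num)).clm_apply hF

/-- If some control makes `a + ∑ j, u j * b j` negative, then `a < 0` wherever `b` vanishes. -/
lemma sum_sq_ne_zero_or_neg_of_iInf_lt {a : ℝ} {b : Fin m → ℝ}
    (h : (⨅ u : EuclideanSpace ℝ (Fin m), ((a + ∑ j, u j * b j : ℝ) : EReal)) < 0) :
    ∑ j, b j ^ 2 ≠ 0 ∨ a < 0 := by
  by_cases hb : ∑ j, b j ^ 2 = 0
  · right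
    rw [Finset.sum_eq_zero_iff_of_nonneg fun j _ => sq_nonneg _] at hb
    obtain ⟨u, hu⟩ := iInf_lt_iff.1 h
    have h0 : ∑ j, u j * b j = 0 :=
      Finset.sum_eq_zero fun j hj => by simp [pow_eq_zero_iff two_ne_zero |>.1 (hb j hj)]
    rw [h0, add_zero] at hu
    exact_mod_cast hu
  · exact Or.inl hb

lemma contDiffAt_closedLoop (hf : ContDiff ℝ 2 (f i)) (hg : ∀ j, ContDiff ℝ 2 (g i j))
    (hV : ContDiff ℝ 2 (V i)) {x : EuclideanSpace ℝ (Fin n)}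
    (h : ∑ j, lieD (g i j) (V i) x ^ 2 ≠ 0 ∨ lieD (f i) (V i) x + rate i * V i x < 0) :
    ContDiffAt ℝ 1 (closedLoop f g (universalFeedback f g V rate) i) x := by
  have hf1 : ContDiff ℝ 1 (f i) := hf.of_le (by norm_num)
  have hg1 : ∀ j, ContDiff ℝ 1 (g i j) := fun j => (hg j).of_le (by norm_num)
  have hV1 : ContDiff ℝ 1 (V i) := hV.of_le (by norm_num)
  have ha : ContDiff ℝ 1 fun y => lieD (f i) (V i) y + rate i * V i y :=
    (contDiff_lieD hV hf1).add (contDiff_const.mul hV1)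
  have hb : ContDiff ℝ 1 fun y => ∑ j, lieD (g i j) (V i) y ^ 2 :=
    ContDiff.sum fun j _ => (contDiff_lieD hV (hg1 j)).pow 2
  have hphi : ContDiffAt ℝ 1 (fun y => phi (lieD (f i) (V i) y + rate i * V i y)
      (∑ j, lieD (g i j) (V i) y ^ 2)) x :=
    ContDiffAt.comp x (f := fun y => (lieD (f i) (V i) y + rate i * V i y,
      ∑ j, lieD (g i j) (V i) y ^ 2)) (contDiffAt_phi h) (ha.contDiffAt.prodMk hb.contDiffAt)
  exact hf1.contDiffAt.add <| ContDiffAt.sum fun j _ =>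
    ((contDiff_lieD hV (hg1 j)).neg.contDiffAt.mul hphi).smul (hg1 j).contDiffAt

/-- The derivative is L_f V - φβ. If β ≠ 0 this equals -λ_i V - √(a² + β²); if β = 0 the feedback
vanishes and a ≤ 0 is what is needed. The inequality on a is weak so that the origin is included. -/
lemma fderiv_closedLoop_le (x : EuclideanSpace ℝ (Fin n))
    (h : ∑ j, lieD (g i j) (V i) x ^ 2 ≠ 0 ∨ lieD (f i) (V i) x + rate i * V i x ≤ 0) :
    fderiv ℝ (V i) x (closedLoop f g (universalFeedback f g V rate) i x) ≤ -rate i * V i x := by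
  set a := lieD (f i) (V i) x + rate i * V i x with ha
  set β := ∑ j, lieD (g i j) (V i) x ^ 2 with hβ
  have h1 : fderiv ℝ (V i) x (closedLoop f g (universalFeedback f g V rate) i x) =
      lieD (f i) (V i) x - phi a β * β := by
    simp only [closedLoop, map_add, map_sum, map_smul, smul_eq_mul, ← lieD_eq_fderiv,
      universalFeedback, ← ha, ← hβ]
    rw [hβ, Finset.mul_sum, sub_eq_add_neg, ← Finset.sum_neg_distrib]
    congr 1
    exact Finset.sum_congr rfl fun j _ => by ring
  rw [h1]
  by_cases hb : β = 0
  · have := h.resolve_left (not_not.2 hb)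
    rw [hb, mul_zero]
    linarith
  · rw [phi_mul_self hb]
    have := Real.sqrt_nonneg (a ^ 2 + β ^ 2)
    linarith

/-- The universal feedback is bounded by twice the size of any admissible control plus the norm
of the vector of Lie derivatives. -/
lemma abs_universalFeedback_le {x : EuclideanSpace ℝ (Fin n)} {u : EuclideanSpace ℝ (Fin m)}
    (hu : lieD (f i) (V i) x + ∑ j, u j * lieD (g i j) (V i) x ≤ -rate i * V i x) (j : Fin m) :
    |universalFeedback f g V rate i j x| ≤
      2 * ‖u‖ + √(∑ j, lieD (g i j) (V i) x ^ 2) := by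
  set a := lieD (f i) (V i) x + rate i * V i x with ha
  set β := ∑ j, lieD (g i j) (V i) x ^ 2 with hβ
  have hβ0 : 0 ≤ β := Finset.sum_nonneg fun j _ => sq_nonneg _
  have hCS : |∑ j, u j * lieD (g i j) (V i) x| ≤ ‖u‖ * √β := by
    have h := abs_real_inner_le_norm u (WithLp.toLp 2 fun j => lieD (g i j) (V i) x)
    rw [EuclideanSpace.norm_eq (WithLp.toLp 2 fun j => lieD (g i j) (V i) x)] at h
    simpa [PiLp.inner_apply, mul_comm, hβ] using h
  -- Cauchy–Schwarz bounds what the control u can contribute, hence how positive a can be.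
  have hac : a ≤ ‖u‖ * √β := by
    have := (abs_le.1 hCS).1
    linarith
  have hle := phi_mul_le hβ0 hac (by positivity)
  have hbj : |lieD (g i j) (V i) x| ≤ √β := by
    refine Real.abs_le_sqrt ?_
    exact Finset.single_le_sum (f := fun j => lieD (g i j) (V i) x ^ 2)
      (fun j _ => sq_nonneg _) (Finset.mem_univ j)
  have hk : |universalFeedback f g V rate i j x| ≤ √β * phi a β := by
    rw [universalFeedback, abs_mul, abs_neg, ← ha, ← hβ, abs_of_nonneg (phi_nonneg hβ0)]
    exact mul_le_mul_of_nonneg_right hbj (phi_nonneg hβ0)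
  refine hk.trans ?_
  rcases (Real.sqrt_nonneg β).eq_or_lt with h0 | h0
  · rw [← h0]
    simp
  · refine le_of_mul_le_mul_right ?_ h0
    have hsq := Real.mul_self_sqrt hβ0
    calc √β * phi a β * √β = phi a β * (√β * √β) := by ring
      _ ≤ 2 * (‖u‖ * √β) + √β * √β := by rwa [hsq]
      _ = _ := by ring

lemma closedLoop_zero (hf0 : f i 0 = 0) (hg0 : ∀ j, g i j 0 = 0)
    (k : Fin N → Fin m → EuclideanSpace ℝ (Fin n) → ℝ) : closedLoop f g k i 0 = 0 := by
  simp [closedLoop, hf0, hg0]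

/-- A continuously differentiable vector field vanishing at the origin grows at most linearly on
balls. -/
lemma exists_norm_le_mul_of_contDiff {E : Type*} [NormedAddCommGroup E] [NormedSpace ℝ E]
    [FiniteDimensional ℝ E] {F : E → E} (hF : ContDiff ℝ 1 F) (hF0 : F 0 = 0) (R : ℝ) :
    ∃ C, 0 ≤ C ∧ ∀ x, ‖x‖ ≤ R → ‖F x‖ ≤ C * ‖x‖ := by
  obtain ⟨K, hK⟩ := hF.contDiffOn.exists_lipschitzOnWith one_ne_zero
    (convex_closedBall (0 : E) R) (isCompact_closedBall 0 R)
  refine ⟨K, K.2, fun x hx => ?_⟩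
  have h := hK.norm_sub_le (y := 0) (mem_closedBall_zero_iff.2 hx)
    (Metric.mem_closedBall_self ((norm_nonneg x).trans hx))
  simpa [hF0] using h

/-- The closed-loop vector field grows at most linearly on balls. -/
lemma exists_norm_closedLoop_le (hf : ContDiff ℝ 2 (f i)) (hg : ∀ j, ContDiff ℝ 2 (g i j))
    (hf0 : f i 0 = 0) (hg0 : ∀ j, g i j 0 = 0) (hV : ContDiff ℝ 2 (V i))
    (hreg : ∀ x, x ≠ 0 → ∑ j, lieD (g i j) (V i) x ^ 2 ≠ 0 ∨
      lieD (f i) (V i) x + rate i * V i x < 0)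
    {δ : ℝ} (hδ : 0 < δ) (hSCP : ∀ x, x ≠ 0 → ‖x‖ < δ → ∃ u : EuclideanSpace ℝ (Fin m), ‖u‖ < 1 ∧
      lieD (f i) (V i) x + ∑ j, u j * lieD (g i j) (V i) x ≤ -rate i * V i x) (R : ℝ) :
    ∃ C, 0 ≤ C ∧ ∀ x, ‖x‖ ≤ R →
      ‖closedLoop f g (universalFeedback f g V rate) i x‖ ≤ C * ‖x‖ := by
  have hg1 : ∀ j, ContDiff ℝ 1 (g i j) := fun j => (hg j).of_le (by norm_num)
  set F := closedLoop f g (universalFeedback f g V rate) i with hF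
  -- near the origin
  obtain ⟨Cf, hCf0, hCf⟩ := exists_norm_le_mul_of_contDiff (hf.of_le (by norm_num)) hf0 δ
  choose Cg hCg0 hCg using fun j => exists_norm_le_mul_of_contDiff (hg1 j) (hg0 j) δ
  have hbcont : Continuous fun x => √(∑ j, lieD (g i j) (V i) x ^ 2) :=
    (continuous_finsetSum _ fun j _ =>
      (contDiff_lieD hV (hg1 j)).continuous.pow 2).sqrt
  obtain ⟨B, hB⟩ := (isCompact_closedBall (0 : EuclideanSpace ℝ (Fin n)) δ)
    |>.exists_bound_of_continuousOn hbcont.continuousOn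
  -- Boundedness of the feedback suffices here: the factor ‖x‖ comes from g_{i,j}, which vanishes at
  -- 0.
  have hnear : ∀ x, ‖x‖ < δ → ‖F x‖ ≤ (Cf + ∑ j, (2 + B) * Cg j) * ‖x‖ := by
    intro x hx
    rcases eq_or_ne x 0 with rfl | hx0
    · simp [hF, closedLoop_zero hf0 hg0]
    obtain ⟨u, hu1, hu⟩ := hSCP x hx0 hx
    rw [add_mul, Finset.sum_mul]
    refine norm_add_le_of_le (hCf x hx.le) (norm_sum_le_of_le _ fun j _ => ?_)
    rw [norm_smul, mul_assoc]
    refine mul_le_mul ?_ (hCg j x hx.le) (norm_nonneg _) ?_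
    · refine (abs_universalFeedback_le hu j).trans ?_
      have := hB x (mem_closedBall_zero_iff.2 hx.le)
      rw [Real.norm_of_nonneg (Real.sqrt_nonneg _)] at this
      linarith
    · have := (norm_nonneg _).trans (hB x (mem_closedBall_zero_iff.2 hx.le))
      linarith
  -- away from the origin
  have hK : IsCompact (Metric.closedBall (0 : EuclideanSpace ℝ (Fin n)) R \ Metric.ball 0 δ) :=
    (isCompact_closedBall 0 R).diff Metric.isOpen_ball
  obtain ⟨M, hM⟩ := hK.exists_bound_of_continuousOn (f := F) fun x hx => by
    have hx0 : x ≠ 0 := by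
      rintro rfl
      exact hx.2 (Metric.mem_ball_self hδ)
    exact (contDiffAt_closedLoop hf hg hV (hreg x hx0)).continuousAt.continuousWithinAt
  -- The inner maximum with 0 covers an empty annulus, where M may be negative.
  refine ⟨max (Cf + ∑ j, (2 + B) * Cg j) (max (M / δ) 0), by positivity, fun x hx => ?_⟩
  rcases lt_or_ge ‖x‖ δ with hxδ | hxδ
  · exact (hnear x hxδ).trans (by gcongr; exact le_max_left _ _)
  · have hMx := hM x ⟨mem_closedBall_zero_iff.2 hx, by simpa using hxδ⟩
    calc ‖F x‖ ≤ M := hMx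
      _ = M / δ * δ := (div_mul_cancel₀ _ hδ.ne').symm
      _ ≤ M / δ * ‖x‖ :=
        mul_le_mul_of_nonneg_left hxδ (div_nonneg ((norm_nonneg _).trans hMx) hδ.le)
      _ ≤ _ := by
        gcongr
        exact (le_max_left _ _).trans (le_max_right _ _)

end VectorField

/-! ### Existence and uniqueness for one mode with a field that is C¹ off the origin. -/

section Autonomous

variable {E : Type*} [NormedAddCommGroup E] [InnerProductSpace ℝ E]

/-- `x` is differentiable on `[a, b]` and satisfies `ẋ = F(x)` there. -/
def IsTrajectory (F : E → E) (a b : ℝ) (x : ℝ → E) : Prop :=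
  ∀ t ∈ Icc a b, HasDerivWithinAt x (F (x t)) (Icc a b) t

/-- A vector field that is continuously differentiable off the origin, grows at most linearly near
the origin, and has a proper Lyapunov-like function `W` with exponential rate `c` of any sign. -/
structure IsDampedField (F : E → E) (W : E → ℝ) (c : ℝ) : Prop where
  contDiffAt : ∀ x, x ≠ 0 → ContDiffAt ℝ 1 F x
  linear_growth : ∀ R : ℝ, ∃ C, 0 ≤ C ∧ ∀ x, ‖x‖ ≤ R → ‖F x‖ ≤ C * ‖x‖
  differentiable : Differentiable ℝ W
  nonneg : ∀ x, 0 ≤ W x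
  proper : ∀ M : ℝ, ∃ R, ∀ x, W x ≤ M → ‖x‖ ≤ R
  decay : ∀ x, fderiv ℝ W x (F x) ≤ -c * W x

/-- Linear differential inequality. -/
lemma le_mul_exp_of_deriv_le {h h' : ℝ → ℝ} {a b k : ℝ}
    (hd : ∀ t ∈ Icc a b, HasDerivWithinAt h (h' t) (Icc a b) t)
    (hle : ∀ t ∈ Icc a b, h' t ≤ k * h t) {t : ℝ} (ht : t ∈ Icc a b) :
    h t ≤ h a * Real.exp (k * (t - a)) := by
  have he : ∀ t, HasDerivAt (fun t => Real.exp (-k * (t - a)))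
      (Real.exp (-k * (t - a)) * (-k * 1)) t := fun t =>
    (((hasDerivAt_id t).sub_const a).const_mul (-k)).exp
  have hp : ∀ t ∈ Icc a b, HasDerivWithinAt (fun t => h t * Real.exp (-k * (t - a)))
      (h' t * Real.exp (-k * (t - a)) + h t * (Real.exp (-k * (t - a)) * (-k * 1)))
      (Icc a b) t := fun t ht => (hd t ht).mul (he t).hasDerivWithinAt
  -- Integrating factor: the hypothesis says exactly that h(t) e^{-k(t-a)} has nonpositive
  -- derivative.
  have hanti : AntitoneOn (fun t => h t * Real.exp (-k * (t - a))) (Icc a b) := by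
    refine antitoneOn_of_hasDerivWithinAt_nonpos (convex_Icc a b)
      (fun t ht => (hp t ht).continuousWithinAt)
      (fun t ht => (hp t (interior_subset ht)).mono interior_subset) fun t ht => ?_
    have h1 := hle t (interior_subset ht)
    have h2 := Real.exp_pos (-k * (t - a))
    nlinarith
  have h3 : h t * Real.exp (-k * (t - a)) ≤ h a * Real.exp (-k * (a - a)) :=
    hanti (left_mem_Icc.2 (ht.1.trans ht.2)) ht ht.1
  rw [sub_self, mul_zero, Real.exp_zero, mul_one] at h3
  calc h t = h t * Real.exp (-k * (t - a)) * Real.exp (k * (t - a)) := by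
        rw [mul_assoc, ← Real.exp_add]; simp
    _ ≤ _ := mul_le_mul_of_nonneg_right h3 (Real.exp_pos _).le

lemma IsTrajectory.continuousOn {F : E → E} {a b : ℝ} {x : ℝ → E} (hx : IsTrajectory F a b x) :
    ContinuousOn x (Icc a b) := fun t ht => (hx t ht).continuousWithinAt

lemma IsTrajectory.congr_field {F G : E → E} {a b : ℝ} {x : ℝ → E} (hx : IsTrajectory F a b x)
    (h : ∀ t ∈ Icc a b, G (x t) = F (x t)) : IsTrajectory G a b x := fun t ht => by
  rw [h t ht]
  exact hx t ht

lemma IsTrajectory.hasDerivWithinAt_Ici {F : E → E} {a b : ℝ} {x : ℝ → E}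
    (hx : IsTrajectory F a b x) {t : ℝ} (ht : t ∈ Ico a b) :
    HasDerivWithinAt x (F (x t)) (Ici t) t :=
  (hx t (Ico_subset_Icc_self ht)).mono_of_mem_nhdsWithin (Icc_mem_nhdsGE_of_mem ht)

/-- Two-sided exponential bounds on the norm of a trajectory. -/
lemma IsTrajectory.norm_sq_bounds {F : E → E} {a b : ℝ} {x : ℝ → E} (hx : IsTrajectory F a b x)
    {C : ℝ} (hC : ∀ t ∈ Icc a b, ‖F (x t)‖ ≤ C * ‖x t‖) {t : ℝ} (ht : t ∈ Icc a b) :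
    ‖x t‖ ^ 2 ≤ ‖x a‖ ^ 2 * Real.exp (2 * C * (t - a)) ∧
      ‖x a‖ ^ 2 * Real.exp (-(2 * C) * (t - a)) ≤ ‖x t‖ ^ 2 := by
  have hd : ∀ t ∈ Icc a b, HasDerivWithinAt (fun t => ‖x t‖ ^ 2) (2 * inner ℝ (x t) (F (x t)))
      (Icc a b) t := fun t ht => (hx t ht).norm_sq
  have habs : ∀ t ∈ Icc a b, |inner ℝ (x t) (F (x t))| ≤ C * ‖x t‖ ^ 2 := fun t ht =>
    (abs_real_inner_le_norm _ _).trans <|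
      (mul_le_mul_of_nonneg_left (hC t ht) (norm_nonneg _)).trans_eq (by ring)
  constructor
  · exact le_mul_exp_of_deriv_le hd (fun t ht => by linarith [(abs_le.1 (habs t ht)).2]) ht
  · have h := le_mul_exp_of_deriv_le (h := fun t => -‖x t‖ ^ 2) (k := -(2 * C))
      (fun t ht => (hd t ht).neg) (fun t ht => by linarith [(abs_le.1 (habs t ht)).1]) ht
    linarith

/-- Linear growth allows at most exponential approach to 0, so a nonzero trajectory keeps a fixed
distance from the origin, the only point where C¹ regularity may fail. -/
lemma IsTrajectory.le_norm {F : E → E} {a b : ℝ} {x : ℝ → E} (hx : IsTrajectory F a b x)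
    {C : ℝ} (hC0 : 0 ≤ C) (hC : ∀ t ∈ Icc a b, ‖F (x t)‖ ≤ C * ‖x t‖) {t : ℝ}
    (ht : t ∈ Icc a b) : ‖x a‖ * Real.exp (-C * (b - a)) ≤ ‖x t‖ := by
  refine le_of_sq_le_sq ?_ (norm_nonneg _)
  refine le_trans ?_ (hx.norm_sq_bounds hC ht).2
  rw [mul_pow, ← Real.exp_nat_mul]
  refine mul_le_mul_of_nonneg_left (Real.exp_le_exp.2 ?_) (sq_nonneg _)
  push_cast
  nlinarith [ht.2]

/-- A Lyapunov-like function along a trajectory. -/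
lemma IsTrajectory.lyapunov_le {F : E → E} {W : E → ℝ} (hW : Differentiable ℝ W) {c : ℝ}
    (hdec : ∀ x, fderiv ℝ W x (F x) ≤ -c * W x) {a b : ℝ} {x : ℝ → E}
    (hx : IsTrajectory F a b x) {t : ℝ} (ht : t ∈ Icc a b) :
    W (x t) ≤ W (x a) * Real.exp (-c * (t - a)) :=
  le_mul_exp_of_deriv_le (fun t ht => (hW (x t)).hasFDerivAt.comp_hasDerivWithinAt t (hx t ht))
    (fun t _ => hdec (x t)) ht

/-- A smooth cutoff to an annulus of a vector field that is smooth off the origin. -/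
lemma exists_cutoff [FiniteDimensional ℝ E] {F : E → E}
    (hF : ∀ x, x ≠ 0 → ContDiffAt ℝ 1 F x) {r R : ℝ} (hr : 0 < r) (hR : 0 ≤ R) :
    ∃ χ : E → ℝ, (∀ x, 0 ≤ χ x ∧ χ x ≤ 1) ∧ (∀ x, r ≤ ‖x‖ → ‖x‖ ≤ R → χ x = 1) ∧
      ∃ K L : ℝ≥0, LipschitzWith K (fun x => χ x • F x) ∧ ∀ x, ‖χ x • F x‖ ≤ L := by
  -- The first factor is 0 for ‖x‖² ≤ r²/2 and 1 for ‖x‖ ≥ r; the second is 1 for ‖x‖ ≤ R and 0 for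
  -- ‖x‖² ≥ R² + 1. Squared norms keep χ smooth at 0.
  set χ : E → ℝ := fun x =>
    Real.smoothTransition (2 / r ^ 2 * ‖x‖ ^ 2 - 1) *
      Real.smoothTransition (R ^ 2 + 1 - ‖x‖ ^ 2) with hχ
  have hsm : ContDiff ℝ 1 χ :=
    (Real.smoothTransition.contDiff.comp
      ((contDiff_const.mul (contDiff_norm_sq ℝ)).sub contDiff_const)).mul
    (Real.smoothTransition.contDiff.comp (contDiff_const.sub (contDiff_norm_sq ℝ)))
  have hG : ContDiff ℝ 1 fun x => χ x • F x := by
    rw [contDiff_iff_contDiffAt]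
    intro x
    rcases ne_or_eq x 0 with hx | rfl
    · exact hsm.contDiffAt.smul (hF x hx)
    · refine (contDiffAt_const (c := (0 : E))).congr_of_eventuallyEq ?_
      have hcont : ContinuousAt (fun x : E => 2 / r ^ 2 * ‖x‖ ^ 2 - 1) 0 := by fun_prop
      filter_upwards [hcont.eventually_lt continuousAt_const
        (show 2 / r ^ 2 * ‖(0 : E)‖ ^ 2 - 1 < 0 by simp)] with x hx
      simp [hχ, Real.smoothTransition.zero_of_nonpos hx.le]
  have hcs : HasCompactSupport fun x => χ x • F x := by
    refine HasCompactSupport.intro (isCompact_closedBall (0 : E) (R + 1)) fun x hx => ?_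
    have hx' : R + 1 < ‖x‖ := by simpa using hx
    have : R ^ 2 + 1 - ‖x‖ ^ 2 ≤ 0 := by nlinarith
    simp [hχ, Real.smoothTransition.zero_of_nonpos this]
  refine ⟨χ, fun x => ⟨mul_nonneg (Real.smoothTransition.nonneg _) (Real.smoothTransition.nonneg _),
    mul_le_one₀ (Real.smoothTransition.le_one _) (Real.smoothTransition.nonneg _)
      (Real.smoothTransition.le_one _)⟩, fun x h1 h2 => ?_, ?_⟩
  · have h3 : 1 ≤ 2 / r ^ 2 * ‖x‖ ^ 2 - 1 := by
      have : r ^ 2 ≤ ‖x‖ ^ 2 := by gcongr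
      have : 2 / r ^ 2 * r ^ 2 ≤ 2 / r ^ 2 * ‖x‖ ^ 2 := by gcongr
      rw [div_mul_cancel₀ _ (by positivity)] at this
      linarith
    have h4 : 1 ≤ R ^ 2 + 1 - ‖x‖ ^ 2 := by
      have : ‖x‖ ^ 2 ≤ R ^ 2 := by gcongr
      linarith
    simp [hχ, Real.smoothTransition.one_of_one_le h3, Real.smoothTransition.one_of_one_le h4]
  · obtain ⟨K, hK⟩ := hG.lipschitzWith_of_hasCompactSupport hcs one_ne_zero
    obtain ⟨L, hL⟩ := hcs.exists_bound_of_continuous hG.continuous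
    exact ⟨K, L.toNNReal, hK, fun x => (hL x).trans (Real.le_coe_toNNReal L)⟩

namespace IsDampedField

variable {F : E → E} {W : E → ℝ} {c : ℝ}

lemma map_zero (h : IsDampedField F W c) : F 0 = 0 := by
  obtain ⟨C, -, hC⟩ := h.linear_growth 0
  simpa using hC 0 (by simp)

lemma continuous (h : IsDampedField F W c) : Continuous F := by
  rw [continuous_iff_continuousAt]
  intro x
  rcases ne_or_eq x 0 with hx | rfl
  · exact (h.contDiffAt x hx).continuousAt
  · obtain ⟨C, -, hC⟩ := h.linear_growth 1
    have h1 : Tendsto (fun x : E => C * ‖x‖) (𝓝 0) (𝓝 0) := by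
      have : Continuous fun x : E => C * ‖x‖ := by fun_prop
      simpa using this.tendsto 0
    rw [ContinuousAt, h.map_zero]
    refine squeeze_zero_norm' ?_ h1
    filter_upwards [Metric.closedBall_mem_nhds (0 : E) one_pos] with x hx
    exact hC x (mem_closedBall_zero_iff.1 hx)

/-- Existence of trajectories on bounded intervals. -/
lemma exists_isTrajectory [FiniteDimensional ℝ E] (h : IsDampedField F W c) {a b : ℝ}
    (hab : a ≤ b) (x₀ : E) : ∃ x, x a = x₀ ∧ IsTrajectory F a b x := by
  rcases eq_or_ne x₀ 0 with rfl | hx₀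
  · refine ⟨fun _ => 0, rfl, fun t _ => ?_⟩
    rw [h.map_zero]
    exact hasDerivWithinAt_const _ _ _
  -- The rate is |c| because R must also confine trajectories of χF: scaling by χ ∈ [0,1] can lose
  -- decay but never produces growth faster than |c|.
  obtain ⟨R, hR⟩ := h.proper (W x₀ * Real.exp (|c| * (b - a)))
  obtain ⟨C, hC0, hC⟩ := h.linear_growth R
  have hx₀R : ‖x₀‖ ≤ R := hR x₀ <| le_mul_of_one_le_right (h.nonneg _) <|
    Real.one_le_exp (mul_nonneg (abs_nonneg c) (sub_nonneg.2 hab))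
  obtain ⟨χ, hχ, hχ1, K, L, hK, hL⟩ := exists_cutoff h.contDiffAt
    (r := ‖x₀‖ * Real.exp (-C * (b - a))) (by positivity) ((norm_nonneg _).trans hx₀R)
  -- The cutoff field is bounded by L everywhere, so a ball of radius L(b - a) allows
  -- Picard–Lindelöf on the whole interval at once.
  have hPL : IsPicardLindelof (fun _ x => χ x • F x)
      (⟨a, left_mem_Icc.2 hab⟩ : Icc a b) x₀ (L * (b - a).toNNReal) 0 L K :=
    IsPicardLindelof.of_time_independent (fun x _ => hL x) hK.lipschitzOnWith (by
      simp [Real.coe_toNNReal _ (sub_nonneg.2 hab), sub_nonneg.2 hab])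
  obtain ⟨x, hxa, hx⟩ := hPL.exists_eq_forall_mem_Icc_hasDerivWithinAt₀
  have hxa' : x a = x₀ := hxa
  have hxt : IsTrajectory (fun x => χ x • F x) a b x := hx
  have hWdec : ∀ y, fderiv ℝ W y (χ y • F y) ≤ -(-|c|) * W y := fun y => by
    rw [map_smul, smul_eq_mul, neg_neg]
    have h1 : fderiv ℝ W y (F y) ≤ |c| * W y :=
      (h.decay y).trans (mul_le_mul_of_nonneg_right (neg_le_abs c) (h.nonneg y))
    have h2 : 0 ≤ |c| * W y := mul_nonneg (abs_nonneg c) (h.nonneg y)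
    nlinarith [(hχ y).1, (hχ y).2]
  have hxR : ∀ t ∈ Icc a b, ‖x t‖ ≤ R := fun t ht => by
    refine hR _ ((hxt.lyapunov_le h.differentiable hWdec ht).trans ?_)
    rw [neg_neg, hxa']
    refine mul_le_mul_of_nonneg_left (Real.exp_le_exp.2 ?_) (h.nonneg _)
    exact mul_le_mul_of_nonneg_left (by linarith [ht.2]) (abs_nonneg c)
  have hxC : ∀ t ∈ Icc a b, ‖χ (x t) • F (x t)‖ ≤ C * ‖x t‖ := fun t ht => by
    rw [norm_smul, Real.norm_of_nonneg (hχ _).1]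
    exact (mul_le_of_le_one_left (norm_nonneg _) (hχ _).2).trans (hC _ (hxR t ht))
  refine ⟨x, hxa', hxt.congr_field fun t ht => ?_⟩
  have hlow := hxt.le_norm hC0 hxC ht
  rw [hxa'] at hlow
  simp [hχ1 _ hlow (hxR t ht)]

/-- Uniqueness of trajectories. -/
lemma eqOn_of_isTrajectory [FiniteDimensional ℝ E] (h : IsDampedField F W c) {a b : ℝ}
    {x y : ℝ → E} (hx : IsTrajectory F a b x) (hy : IsTrajectory F a b y) (hxy : x a = y a) :
    EqOn x y (Icc a b) := by
  obtain ⟨R₁, hR₁⟩ := isCompact_Icc.exists_bound_of_continuousOn hx.continuousOn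
  obtain ⟨R₂, hR₂⟩ := isCompact_Icc.exists_bound_of_continuousOn hy.continuousOn
  set R := max (max R₁ R₂) 0 with hR
  have hxR : ∀ t ∈ Icc a b, ‖x t‖ ≤ R := fun t ht =>
    (hR₁ t ht).trans ((le_max_left _ _).trans (le_max_left _ _))
  have hyR : ∀ t ∈ Icc a b, ‖y t‖ ≤ R := fun t ht =>
    (hR₂ t ht).trans ((le_max_right _ _).trans (le_max_left _ _))
  obtain ⟨C, hC0, hC⟩ := h.linear_growth R
  have hxC : ∀ t ∈ Icc a b, ‖F (x t)‖ ≤ C * ‖x t‖ := fun t ht => hC _ (hxR t ht)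
  have hyC : ∀ t ∈ Icc a b, ‖F (y t)‖ ≤ C * ‖y t‖ := fun t ht => hC _ (hyR t ht)
  rcases eq_or_ne (x a) 0 with h0 | h0
  · intro t ht
    have h1 := (hx.norm_sq_bounds hxC ht).1
    have h2 := (hy.norm_sq_bounds hyC ht).1
    rw [← hxy] at h2
    simp only [h0, norm_zero, ne_eq, OfNat.ofNat_ne_zero, not_false_eq_true, zero_pow,
      zero_mul] at h1 h2
    have h1' : x t = 0 := by simpa using le_antisymm h1 (sq_nonneg _)
    have h2' : y t = 0 := by simpa using le_antisymm h2 (sq_nonneg _)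
    rw [h1', h2']
  -- Both trajectories stay in this annulus, so both solve the same globally Lipschitz equation.
  · obtain ⟨χ, -, hχ1, K, -, hK, -⟩ := exists_cutoff h.contDiffAt
      (r := ‖x a‖ * Real.exp (-C * (b - a))) (R := R) (by positivity) (le_max_right _ _)
    have hx' : IsTrajectory (fun z => χ z • F z) a b x := hx.congr_field fun t ht => by
      simp [hχ1 _ (hx.le_norm hC0 hxC ht) (hxR t ht)]
    have hy' : IsTrajectory (fun z => χ z • F z) a b y := hy.congr_field fun t ht => by
      simp [hχ1 _ (hxy ▸ hy.le_norm hC0 hyC ht) (hyR t ht)]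
    exact ODE_solution_unique (fun _ => hK) hx.continuousOn
      (fun t ht => hx'.hasDerivWithinAt_Ici ht) hy.continuousOn
      (fun t ht => hy'.hasDerivWithinAt_Ici ht) hxy

end IsDampedField

end Autonomous

/-! ### Deterministic switched systems: gluing, uniqueness and Lyapunov growth. -/

section Switched

variable {n N : ℕ} {F : Fin N → EuclideanSpace ℝ (Fin n) → EuclideanSpace ℝ (Fin n)}
  {W : Fin N → EuclideanSpace ℝ (Fin n) → ℝ} {c : Fin N → ℝ}
  {s : ℝ → Fin N} {x₀ : EuclideanSpace ℝ (Fin n)} {x y : ℝ → EuclideanSpace ℝ (Fin n)}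

lemma IsSolutionOn.mono {T T' : ℝ} (hx : IsSolutionOn F s x₀ T x) (h0 : 0 ≤ T') (hT : T' ≤ T) :
    IsSolutionOn F s x₀ T' x := by
  refine ⟨hx.1.mono (Icc_subset_Icc_right hT), hx.2.1.mono_set ?_,
    fun t ht => hx.2.2 t ⟨ht.1, ht.2.trans hT⟩⟩
  rw [uIcc_of_le h0, uIcc_of_le (h0.trans hT)]
  exact Icc_subset_Icc_right hT

lemma IsSolutionOn.eval_zero {T : ℝ} (hx : IsSolutionOn F s x₀ T x) (hT : 0 ≤ T) : x 0 = x₀ := by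
  simpa using hx.2.2 0 ⟨le_rfl, hT⟩

lemma IsSolutionOn.congr {T : ℝ} (hx : IsSolutionOn F s x₀ T x) (hT : 0 ≤ T)
    (hxy : EqOn y x (Icc 0 T)) : IsSolutionOn F s x₀ T y := by
  have hsub : ∀ t ∈ Icc 0 T, uIoc 0 t ⊆ Icc 0 T := fun t ht r hr => by
    rw [uIoc_of_le ht.1] at hr
    exact ⟨hr.1.le, hr.2.trans ht.2⟩
  refine ⟨hx.1.congr hxy, hx.2.1.congr fun r hr => ?_, fun t ht => ?_⟩
  · simp only [hxy (hsub T ⟨hT, le_rfl⟩ hr)]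
  · rw [hxy ht, hx.2.2 t ht]
    congr 1
    refine intervalIntegral.integral_congr_ae (ae_of_all _ fun r hr => ?_)
    simp only [hxy (hsub t ht hr)]

/-- On an interval where the signal is constant, a solution is a trajectory of the active mode. -/
lemma IsSolutionOn.isTrajectory {T : ℝ} (hx : IsSolutionOn F s x₀ T x) {i : Fin N}
    (hF : Continuous (F i)) {a b : ℝ} (ha : 0 ≤ a) (hb : b ≤ T)
    (hs : ∀ t ∈ Ioo a b, s t = i) : IsTrajectory (F i) a b x := by
  intro t ht
  have hab : a ≤ b := ht.1.trans ht.2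
  have hcont : ContinuousOn x (Icc a b) := hx.1.mono (Icc_subset_Icc ha hb)
  have hint : ∀ u v, u ∈ Icc 0 T → v ∈ Icc 0 T →
      IntervalIntegrable (fun r => F (s r) (x r)) volume u v := fun u v hu hv =>
    hx.2.1.mono_set <| by
      rw [uIcc_of_le (hu.1.trans hu.2)]
      exact uIcc_subset_Icc hu hv
  have heq : ∀ u ∈ Icc a b, x u = ODE.picard (fun _ => F i) a (x a) x u := by
    intro u hu
    have huT : u ∈ Icc 0 T := ⟨ha.trans hu.1, hu.2.trans hb⟩
    have haT : a ∈ Icc 0 T := ⟨ha, hab.trans hb⟩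
    have h0T : (0 : ℝ) ∈ Icc 0 T := ⟨le_rfl, ha.trans haT.2⟩
    rw [ODE.picard_apply, hx.2.2 u huT, hx.2.2 a haT, add_assoc,
      ← intervalIntegral.integral_add_adjacent_intervals (hint 0 a h0T haT) (hint a u haT huT)]
    congr 2
    exact intervalIntegral.integral_congr_Ioo_of_le hu.1 fun r hr => by
      simp only [hs r ⟨hr.1, hr.2.trans_le hu.2⟩]
  refine (ODE.hasDerivWithinAt_picard_Icc (f := fun _ => F i) (u := univ) (left_mem_Icc.2 hab)
    (hF.comp continuous_snd).continuousOn hcont (fun _ _ => mem_univ _) (x a) ht).congr heq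
    (heq t ht)

/-- A solution can be prolonged by a trajectory of the active mode. -/
lemma IsSolutionOn.prolong {a b : ℝ} (hx : IsSolutionOn F s x₀ a x) (ha : 0 ≤ a) (hab : a ≤ b)
    {i : Fin N} (hF : Continuous (F i)) (hs : ∀ t ∈ Ioo a b, s t = i)
    (hy : IsTrajectory (F i) a b y) (hxy : y a = x a) :
    IsSolutionOn F s x₀ b (fun t => if t ≤ a then x t else y t) := by
  set z : ℝ → EuclideanSpace ℝ (Fin n) := fun t => if t ≤ a then x t else y t with hz
  have hzx : EqOn z x (Icc 0 a) := fun t ht => if_pos ht.2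
  have hzy : EqOn z y (Icc a b) := fun t ht => by
    rcases ht.1.eq_or_lt with rfl | h
    · simp [hz, hxy]
    · exact if_neg h.not_ge
  have hzsol : IsSolutionOn F s x₀ a z := hx.congr ha hzx
  have hzcont : ContinuousOn z (Icc a b) := hy.continuousOn.congr hzy
  have hFz : ContinuousOn (fun r => F i (z r)) (Icc a b) := hF.comp_continuousOn hzcont
  have hint : ∀ t ∈ Icc a b, IntervalIntegrable (fun r => F (s r) (z r)) volume a t := by
    intro t ht
    have h1 : IntervalIntegrable (fun r => F i (z r)) volume a t :=
      (hFz.mono (by rw [uIcc_of_le ht.1]; exact Icc_subset_Icc_right ht.2)).intervalIntegrable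
    refine h1.congr_uIoo fun r hr => ?_
    rw [uIoo_of_le ht.1] at hr
    simp only [hs r ⟨hr.1, hr.2.trans_le ht.2⟩]
  refine ⟨?_, hzsol.2.1.trans (hint b ⟨hab, le_rfl⟩), fun t ht => ?_⟩
  · rw [← Icc_union_Icc_eq_Icc ha hab]
    exact hzsol.1.union_of_isClosed hzcont isClosed_Icc isClosed_Icc
  · rcases le_total t a with hta | hta
    · exact hzsol.2.2 t ⟨ht.1, hta⟩
    · have htab : t ∈ Icc a b := ⟨hta, ht.2⟩
      have hyt : ODE.picard (fun _ => F i) a (y a) y t = y t :=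
        ODE.picard_eq_of_hasDerivAt (f := fun _ => F i) (u := univ)
          (hF.comp continuous_snd).continuousOn (fun r hr => by
            rw [uIcc_of_le hta] at hr ⊢
            exact (hy r ⟨hr.1, hr.2.trans ht.2⟩).mono (Icc_subset_Icc_right ht.2))
          (fun _ _ => mem_univ _)
      rw [← intervalIntegral.integral_add_adjacent_intervals hzsol.2.1 (hint t htab), ← add_assoc,
        ← hzsol.2.2 a ⟨ha, le_rfl⟩, hzy htab, ← hyt, ODE.picard_apply,
        hzy ⟨le_rfl, hab⟩]
      congr 1
      refine intervalIntegral.integral_congr_Ioo_of_le hta fun r hr => ?_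
      simp only [hs r ⟨hr.1, hr.2.trans_le ht.2⟩, hzy ⟨hr.1.le, hr.2.le.trans ht.2⟩]

variable {τ : ℕ → ℝ}

/-- `τ` is a sequence of switching instants of the deterministic signal `s`, exhausting time. -/
structure IsSwitchingSequence (s : ℝ → Fin N) (τ : ℕ → ℝ) : Prop where
  zero : τ 0 = 0
  strictMono : StrictMono τ
  tendsto_atTop : Tendsto τ atTop atTop
  const : ∀ j, ∀ t ∈ Ico (τ j) (τ (j + 1)), s t = s (τ j)

/-- The growth factor of the Lyapunov functions over the first `j` holding intervals. -/
noncomputable def growthFactor (μ : ℝ) (c : Fin N → ℝ) (mode : ℕ → Fin N) (S : ℕ → ℝ)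
    (j : ℕ) : ℝ := ∏ k ∈ Finset.range j, μ * Real.exp (-c (mode k) * S k)

namespace IsSwitchingSequence

lemma nonneg (hτ : IsSwitchingSequence s τ) (j : ℕ) : 0 ≤ τ j := by
  rw [← hτ.zero]
  exact hτ.strictMono.monotone (Nat.zero_le j)

lemma le_succ (hτ : IsSwitchingSequence s τ) (j : ℕ) : τ j ≤ τ (j + 1) :=
  (hτ.strictMono j.lt_succ_self).le

lemma isTrajectory (hτ : IsSwitchingSequence s τ) (hF : ∀ i, IsDampedField (F i) (W i) (c i))
    {T : ℝ} (hx : IsSolutionOn F s x₀ T x) (j : ℕ) {b : ℝ} (hbT : b ≤ T) (hb : b ≤ τ (j + 1)) :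
    IsTrajectory (F (s (τ j))) (τ j) b x :=
  hx.isTrajectory (hF _).continuous (hτ.nonneg j) hbT
    fun t ht => hτ.const j t ⟨ht.1.le, ht.2.trans_le hb⟩

/-- Uniqueness for the switched system. -/
lemma eqOn (hτ : IsSwitchingSequence s τ) (hF : ∀ i, IsDampedField (F i) (W i) (c i))
    {T : ℝ} (hT : 0 ≤ T) (hx : IsSolutionOn F s x₀ T x) (hy : IsSolutionOn F s x₀ T y) :
    EqOn y x (Icc 0 T) := by
  have key : ∀ j, ∀ t ∈ Icc 0 T, t ≤ τ j → y t = x t := by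
    intro j
    induction j with
    | zero =>
      intro t ht htj
      obtain rfl : t = 0 := le_antisymm (htj.trans_eq hτ.zero) ht.1
      rw [hx.eval_zero hT, hy.eval_zero hT]
    | succ j ih =>
      intro t ht htj
      rcases le_total t (τ j) with h | h
      · exact ih t ht h
      · exact (hF (s (τ j))).eqOn_of_isTrajectory (hτ.isTrajectory hF hy j ht.2 htj)
          (hτ.isTrajectory hF hx j ht.2 htj) (ih _ ⟨hτ.nonneg j, h.trans ht.2⟩ le_rfl) ⟨h, le_rfl⟩
  intro t ht
  obtain ⟨j, hj⟩ := (hτ.tendsto_atTop.eventually_ge_atTop t).exists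
  exact key j t ht hj

/-- Global existence for the switched system. -/
lemma exists_isGlobalSolution (hτ : IsSwitchingSequence s τ)
    (hF : ∀ i, IsDampedField (F i) (W i) (c i)) (x₀ : EuclideanSpace ℝ (Fin n)) :
    ∃ x, IsGlobalSolution F s x₀ x := by
  have key : ∀ j, ∃ x, IsSolutionOn F s x₀ (τ j) x := by
    intro j
    induction j with
    | zero =>
      refine ⟨fun _ => x₀, continuousOn_const, ?_, fun t ht => ?_⟩
      · rw [hτ.zero]
      · obtain rfl : t = 0 := le_antisymm (ht.2.trans_eq hτ.zero) ht.1
        simp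
    | succ j ih =>
      obtain ⟨x, hx⟩ := ih
      obtain ⟨y, hya, hy⟩ := (hF (s (τ j))).exists_isTrajectory (hτ.le_succ j) (x (τ j))
      exact ⟨_, hx.prolong (hτ.nonneg j) (hτ.le_succ j) (hF _).continuous
        (fun t ht => hτ.const j t (Ioo_subset_Ico_self ht)) hy hya⟩
  have hex : ∀ T, 0 ≤ T → ∃ x, IsSolutionOn F s x₀ T x := fun T hT => by
    obtain ⟨j, hj⟩ := (hτ.tendsto_atTop.eventually_ge_atTop T).exists
    obtain ⟨x, hx⟩ := key j
    exact ⟨x, hx.mono hT hj⟩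
  choose! z hz using hex
  -- Solutions on different horizons agree by uniqueness, so the diagonal is a single global
  -- solution.
  refine ⟨fun t => z t t, fun T hT => (hz T hT).congr hT fun t ht => ?_⟩
  exact hτ.eqOn hF ht.1 ((hz T hT).mono ht.1 ht.2) (hz t ht.1) ⟨ht.1, le_rfl⟩

/-- Decay of the active Lyapunov function along a solution of the switched system. -/
lemma lyapunov_le (hτ : IsSwitchingSequence s τ) (hF : ∀ i, IsDampedField (F i) (W i) (c i))
    {μ : ℝ} (hμ : 1 ≤ μ) (hWμ : ∀ i j x, W i x ≤ μ * W j x) (hx : IsGlobalSolution F s x₀ x)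
    (j : ℕ) {t : ℝ} (ht : t ∈ Icc (τ j) (τ (j + 1))) :
    W (s (τ j)) (x t) ≤
      max (growthFactor μ c (fun k => s (τ k)) (fun k => τ (k + 1) - τ k) j)
        (growthFactor μ c (fun k => s (τ k)) (fun k => τ (k + 1) - τ k) (j + 1)) *
        W (s 0) x₀ := by
  set Z := growthFactor μ c (fun k => s (τ k)) (fun k => τ (k + 1) - τ k) with hZ
  have hZs : ∀ j, Z (j + 1) = Z j * (μ * Real.exp (-c (s (τ j)) * (τ (j + 1) - τ j))) :=
    fun j => Finset.prod_range_succ _ _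
  have hZ0 : ∀ j, 0 ≤ Z j := fun j => Finset.prod_nonneg fun k _ => by positivity
  have step : ∀ j, ∀ t ∈ Icc (τ j) (τ (j + 1)),
      W (s (τ j)) (x t) ≤ W (s (τ j)) (x (τ j)) * Real.exp (-c (s (τ j)) * (t - τ j)) :=
    fun j t ht => (hτ.isTrajectory hF (hx _ (hτ.nonneg (j + 1))) j le_rfl le_rfl).lyapunov_le
      (hF _).differentiable (hF _).decay ht
  have hj : ∀ j, W (s (τ j)) (x (τ j)) ≤ Z j * W (s 0) x₀ := by
    intro j
    induction j with
    | zero =>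
      rw [hτ.zero, (hx 0 le_rfl).eval_zero le_rfl]
      simp [hZ, growthFactor]
    | succ j ih =>
      calc W (s (τ (j + 1))) (x (τ (j + 1)))
          ≤ μ * W (s (τ j)) (x (τ (j + 1))) := hWμ _ _ _
        _ ≤ μ * (Z j * W (s 0) x₀ * Real.exp (-c (s (τ j)) * (τ (j + 1) - τ j))) := by
            gcongr
            exact (step j _ (right_mem_Icc.2 (hτ.le_succ j))).trans (by gcongr)
        _ = Z (j + 1) * W (s 0) x₀ := by rw [hZs]; ring
  -- The exponential is monotone between switching instants, so it is largest at an endpoint; at the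
  -- right one the missing factor μ ≥ 1 only helps. Hence the discrete sequence Z controls all
  -- times.
  have hexp : Z j * Real.exp (-c (s (τ j)) * (t - τ j)) ≤ max (Z j) (Z (j + 1)) := by
    rcases le_total 0 (c (s (τ j))) with hc | hc
    · refine le_max_of_le_left (mul_le_of_le_one_right (hZ0 j) (Real.exp_le_one_iff.2 ?_))
      nlinarith [ht.1]
    · refine le_max_of_le_right ?_
      rw [hZs]
      refine mul_le_mul_of_nonneg_left ?_ (hZ0 j)
      refine le_trans (Real.exp_le_exp.2 ?_) (le_mul_of_one_le_left (Real.exp_pos _).le hμ)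
      nlinarith [ht.2]
  calc W (s (τ j)) (x t)
      ≤ Z j * W (s 0) x₀ * Real.exp (-c (s (τ j)) * (t - τ j)) :=
        (step j t ht).trans (mul_le_mul_of_nonneg_right (hj j) (Real.exp_pos _).le)
    _ = Z j * Real.exp (-c (s (τ j)) * (t - τ j)) * W (s 0) x₀ := by ring
    _ ≤ _ := mul_le_mul_of_nonneg_right hexp ((hF _).nonneg _)

/-- Every nonnegative time at or after `τ J` lies in a holding interval of index at least `J`. -/
lemma exists_mem_Icc (hτ : IsSwitchingSequence s τ) {J : ℕ} {t : ℝ} (ht : τ J ≤ t) :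
    ∃ j, J ≤ j ∧ t ∈ Icc (τ j) (τ (j + 1)) := by
  obtain ⟨k, hk⟩ := (hτ.tendsto_atTop.eventually_gt_atTop t).exists
  have hJk : J ≤ k := (hτ.strictMono.lt_iff_lt.1 (ht.trans_lt hk)).le
  induction k, hJk using Nat.le_induction with
  | base => exact absurd hk ht.not_gt
  | succ k hJk ih =>
    rcases le_or_gt (τ k) t with h | h
    · exact ⟨k, hJk, h, hk.le⟩
    · exact ih h

end IsSwitchingSequence

end Switched

/-! ### Expectations of products over memoryless modes and exponential times. -/

section Probability

variable {Ω : Type*} [MeasurableSpace Ω] {P : Measure Ω}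

/-- The Laplace transform of the exponential distribution. -/
lemma lintegral_exp_neg_mul_expMeasure {r c : ℝ} (hr : 0 < r) (hc : 0 < c + r) :
    ∫⁻ s, ENNReal.ofReal (Real.exp (-c * s)) ∂(expMeasure r) = ENNReal.ofReal (r / (c + r)) := by
  have hm : Measurable (exponentialPDF r) :=
    (measurable_exponentialPDFReal r).ennreal_ofReal
  have h1 : expMeasure r = volume.withDensity (exponentialPDF r) := rfl
  rw [h1, lintegral_withDensity_eq_lintegral_mul _ hm (by fun_prop)]
  -- Exponential tilting: the weighted density is a multiple of the exponential density with
  -- parameter c + r.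
  have h2 : ∀ s, (exponentialPDF r * fun s => ENNReal.ofReal (Real.exp (-c * s))) s =
      ENNReal.ofReal (r / (c + r)) * exponentialPDF (c + r) s := by
    intro s
    rcases lt_or_ge s 0 with hs | hs
    · simp [exponentialPDF_of_neg hs]
    · rw [Pi.mul_apply, exponentialPDF_of_nonneg hs, exponentialPDF_of_nonneg hs,
        ← ENNReal.ofReal_mul (by positivity), ← ENNReal.ofReal_mul (by positivity)]
      congr 1
      rw [← mul_assoc, div_mul_cancel₀ _ hc.ne', mul_assoc, ← Real.exp_add]
      congr 2
      ring
  have hm' : Measurable (exponentialPDF (c + r)) :=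
    (measurable_exponentialPDFReal (c + r)).ennreal_ofReal
  simp_rw [h2]
  rw [lintegral_const_mul _ hm', lintegral_exponentialPDF_eq_one hc, mul_one]

/-- A sequence of nonnegative random variables whose expectations decay geometrically tends
to zero almost surely. -/
lemma ae_tendsto_zero_of_lintegral_le_geometric {Z : ℕ → Ω → ℝ} (hZ : ∀ j, Measurable (Z j))
    (hZ0 : ∀ j ω, 0 ≤ Z j ω) {c ρ : ℝ≥0∞} (hc : c ≠ ∞) (hρ : ρ < 1)
    (h : ∀ j, ∫⁻ ω, ENNReal.ofReal (Z (j + 1) ω) ∂P ≤ c * ρ ^ j) :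
    ∀ᵐ ω ∂P, Tendsto (fun j => Z j ω) atTop (𝓝 0) := by
  -- Summable expectations make the series finite almost surely, so its terms tend to 0.
  have hsum : ∫⁻ ω, ∑' j, ENNReal.ofReal (Z (j + 1) ω) ∂P ≠ ∞ := by
    rw [lintegral_tsum fun j => (hZ _).ennreal_ofReal.aemeasurable]
    refine ne_top_of_le_ne_top ?_ (ENNReal.tsum_le_tsum h)
    rw [ENNReal.tsum_mul_left, ENNReal.tsum_geometric]
    exact ENNReal.mul_ne_top hc (ENNReal.inv_ne_top.2 (tsub_pos_of_lt hρ).ne')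
  filter_upwards [ae_lt_top' (AEMeasurable.tsum fun j =>
    (hZ _).ennreal_ofReal.aemeasurable) hsum] with ω hω
  have h1 := ENNReal.tendsto_atTop_zero_of_tsum_ne_top hω.ne
  have h2 := (ENNReal.tendsto_toReal ENNReal.zero_ne_top).comp h1
  rw [← tendsto_add_atTop_iff_nat 1]
  refine h2.congr fun j => ?_
  simp [ENNReal.toReal_ofReal (hZ0 _ ω)]

/-- Expectation of a product of functions of the past and of a memoryless selected mode. -/
lemma lintegral_mul_mode {Ω : Type*} {m m₀ : MeasurableSpace Ω} {P : Measure Ω}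
    [IsProbabilityMeasure P] (hm : m ≤ m₀) {N : ℕ} {X : Ω → Fin N} (hX : Measurable X) {q : Fin N → ℝ}
    (hce : ∀ i, P[{ω | X ω = i}.indicator (fun _ => (1 : ℝ)) | m] =ᵐ[P] fun _ => q i)
    {G : Ω → ℝ≥0∞} (hG : Measurable[m] G) (c : Fin N → ℝ≥0∞) :
    ∫⁻ ω, G ω * c (X ω) ∂P = (∫⁻ ω, G ω ∂P) * ∑ i, ENNReal.ofReal (q i) * c i := by
  have hms : ∀ i, MeasurableSet {ω | X ω = i} := fun i => hX (measurableSet_singleton i)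
  -- A constant conditional probability means that {X = i} is independent of the past, with
  -- probability q_i.
  have key : ∀ i A, MeasurableSet[m] A → P (A ∩ {ω | X ω = i}) = P A * ENNReal.ofReal (q i) := by
    intro i A hA
    have h1 := setIntegral_condExp (μ := P) hm
      (f := {ω | X ω = i}.indicator (fun _ => (1 : ℝ)))
      ((integrable_const 1).indicator (hms i)) hA
    rw [setIntegral_congr_ae (g := fun _ => q i) (hm _ hA)
      ((hce i).mono fun ω h _ => h), integral_indicator (hms i)] at h1
    simp only [integral_const, smul_eq_mul, mul_one, measureReal_restrict_apply_univ,
      Measure.restrict_restrict (hms i)] at h1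
    rw [inter_comm, ← ENNReal.ofReal_toReal (measure_ne_top P ({ω | X ω = i} ∩ A)),
      ← ENNReal.ofReal_toReal (measure_ne_top P A), ← ENNReal.ofReal_mul ENNReal.toReal_nonneg]
    exact congrArg _ h1.symm
  have hP : ∀ i, P {ω | X ω = i} = ENNReal.ofReal (q i) := fun i => by
    simpa using key i univ MeasurableSet.univ
  have hdec : ∀ ω, G ω * c (X ω) = ∑ i, c i * (G ω * {ω | X ω = i}.indicator (fun _ => 1) ω) := by
    intro ω
    rw [Finset.sum_eq_single (X ω)]
    · simp [mul_comm]
    · intro i _ hi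
      simp [hi.symm]
    · simp
  have hGm : Measurable G := hG.mono hm le_rfl
  simp_rw [hdec]
  have hGi : ∀ i, Measurable fun ω => G ω * {ω | X ω = i}.indicator (fun _ => (1 : ℝ≥0∞)) ω :=
    fun i => hGm.mul (measurable_const.indicator (hms i))
  rw [lintegral_finsetSum _ fun i _ => (hGi i).const_mul _, Finset.mul_sum]
  refine Finset.sum_congr rfl fun i _ => ?_
  rw [lintegral_const_mul _ (hGi i),
    lintegral_mul_indicator_eq_lintegral_mul_lintegral_indicator hm 1 (hms i) _ hG,
    lintegral_indicator (hms i)]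
  · simp [hP]
    ring
  · rw [IndepSets_iff]
    rintro A B hA rfl
    rw [key i A hA, hP]

/-- Expectation of the product of functions of a memoryless mode sequence. -/
lemma lintegral_prod_modes [IsProbabilityMeasure P] {N : ℕ} {Y : ℕ → Ω → Fin N}
    (hY : ∀ k, Measurable (Y k)) {σ₀ : Fin N} (hY0 : ∀ ω, Y 0 ω = σ₀) {q : Fin N → ℝ}
   
    (hce : ∀ j, 1 ≤ j → ∀ i, P[{ω | Y j ω = i}.indicator (fun _ => (1 : ℝ)) |
        ⨆ k : Fin j, MeasurableSpace.comap (fun ω => Y k ω) inferInstance] =ᵐ[P] fun _ => q i)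
    (c : Fin N → ℝ≥0∞) (j : ℕ) :
    ∫⁻ ω, ∏ k ∈ Finset.range (j + 1), c (Y k ω) ∂P =
      c σ₀ * (∑ i, ENNReal.ofReal (q i) * c i) ^ j := by
  induction j with
  | zero => simp [hY0]
  | succ j ih =>
    simp_rw [Finset.prod_range_succ _ (j + 1)]
    have hm : (⨆ k : Fin (j + 1), MeasurableSpace.comap (fun ω => Y k ω) inferInstance) ≤
        ‹MeasurableSpace Ω› := iSup_le fun k => (hY k).comap_le
    rw [lintegral_mul_mode hm (hY _) (hce (j + 1) (by omega)) _ c, ih, pow_succ, mul_assoc]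
    refine Finset.measurable_prod _ fun k hk => (measurable_of_finite c).comp ?_
    have h1 : Measurable[MeasurableSpace.comap (fun ω => Y k ω) inferInstance] (Y k) :=
      comap_measurable _
    exact h1.mono (le_iSup (fun k : Fin (j + 1) => MeasurableSpace.comap (fun ω => Y k ω)
      (inferInstance : MeasurableSpace (Fin N))) ⟨k, Finset.mem_range.1 hk⟩) le_rfl

/-- Expectation of the product of functions of i.i.d. holding times and of an independent
memoryless mode sequence. -/
lemma lintegral_prod_modes_times [IsProbabilityMeasure P] {N : ℕ} {Y : ℕ → Ω → Fin N}
    (hY : ∀ k, Measurable (Y k)) {σ₀ : Fin N} (hY0 : ∀ ω, Y 0 ω = σ₀) {q : Fin N → ℝ}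
   
    (hce : ∀ j, 1 ≤ j → ∀ i, P[{ω | Y j ω = i}.indicator (fun _ => (1 : ℝ)) |
        ⨆ k : Fin j, MeasurableSpace.comap (fun ω => Y k ω) inferInstance] =ᵐ[P] fun _ => q i)
    {S : ℕ → Ω → ℝ} (hS : ∀ k, Measurable (S k)) (hSi : iIndepFun S P) {ν : Measure ℝ}
    (hSν : ∀ k, P.map (S k) = ν) (hSY : IndepFun (fun ω k => S k ω) (fun ω k => Y k ω) P)
    {h : Fin N → ℝ → ℝ≥0∞} (hh : ∀ i, Measurable (h i)) (j : ℕ) :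
    ∫⁻ ω, ∏ k ∈ Finset.range (j + 1), h (Y k ω) (S k ω) ∂P =
      (∫⁻ s, h σ₀ s ∂ν) * (∑ i, ENNReal.ofReal (q i) * ∫⁻ s, h i s ∂ν) ^ j := by
  have hSm : Measurable fun ω k => S k ω := measurable_pi_lambda _ hS
  have hYm : Measurable fun ω k => Y k ω := measurable_pi_lambda _ hY
  have huncurry : Measurable fun p : ℝ × Fin N => h p.2 p.1 :=
    measurable_from_prod_countable_left hh
  have heval : ∀ k, Measurable fun p : (ℕ → ℝ) × (ℕ → Fin N) => (p.1 k, p.2 k) := fun k => by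
    fun_prop
  have hΦ : Measurable fun p : (ℕ → ℝ) × (ℕ → Fin N) =>
      ∏ k ∈ Finset.range (j + 1), h (p.2 k) (p.1 k) :=
    Finset.measurable_prod _ fun k _ => huncurry.comp (heval k)
  -- For a frozen mode sequence the factors are independent; Fubini for the product law then
  -- integrates out the times before the modes.
  have hinner : ∀ y : ℕ → Fin N, ∫⁻ ω, ∏ k ∈ Finset.range (j + 1), h (y k) (S k ω) ∂P =
      ∏ k ∈ Finset.range (j + 1), ∫⁻ s, h (y k) s ∂ν := by
    intro y
    rw [lintegral_prod_eq_prod_lintegral_of_indepFun _ (fun k ω => h (y k) (S k ω))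
      (hSi.comp _ fun k => hh (y k)) fun k => (hh _).comp (hS k)]
    refine Finset.prod_congr rfl fun k _ => ?_
    rw [← hSν k, lintegral_map (hh _) (hS k)]
  calc ∫⁻ ω, ∏ k ∈ Finset.range (j + 1), h (Y k ω) (S k ω) ∂P
      = ∫⁻ p, ∏ k ∈ Finset.range (j + 1), h (p.2 k) (p.1 k)
          ∂(P.map fun ω => ((fun k => S k ω), fun k => Y k ω)) :=
        (lintegral_map hΦ (hSm.prodMk hYm)).symm
    _ = ∫⁻ y, ∫⁻ s, ∏ k ∈ Finset.range (j + 1), h (y k) (s k) ∂(P.map fun ω k => S k ω)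
          ∂(P.map fun ω k => Y k ω) := by
        have := Measure.isProbabilityMeasure_map (μ := P) hSm.aemeasurable
        have := Measure.isProbabilityMeasure_map (μ := P) hYm.aemeasurable
        rw [(indepFun_iff_map_prod_eq_prod_map_map hSm.aemeasurable hYm.aemeasurable).1 hSY,
          lintegral_prod_symm' _ hΦ]
    _ = ∫⁻ ω, ∏ k ∈ Finset.range (j + 1), ∫⁻ s, h (Y k ω) s ∂ν ∂P := by
        rw [lintegral_map hΦ.lintegral_prod_left' hYm]
        refine lintegral_congr fun ω => ?_
        rw [← hinner]
        exact lintegral_map (hΦ.comp measurable_prodMk_right) hSm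
    _ = _ := lintegral_prod_modes hY hY0 hce (fun i => ∫⁻ s, h i s ∂ν) j

end Probability

/-! ### From vanishing growth factors to uniform stability and attractivity. -/

section Stability

variable {n N : ℕ} {F : Fin N → EuclideanSpace ℝ (Fin n) → EuclideanSpace ℝ (Fin n)}
  {W : Fin N → EuclideanSpace ℝ (Fin n) → ℝ} {c : Fin N → ℝ} {s : ℝ → Fin N} {τ : ℕ → ℝ}
  {α₁ α₂ : ℝ≥0 → ℝ≥0} {μ : ℝ}

lemma IsClassKInfty.exists_le_of_le (hα : IsClassKInfty α₁) (M : ℝ) :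
    ∃ R : ℝ, ∀ x : EuclideanSpace ℝ (Fin n), (α₁ ‖x‖₊ : ℝ) ≤ M → ‖x‖ ≤ R := by
  obtain ⟨R, hR⟩ := (hα.tendsto_atTop.eventually_gt_atTop M.toNNReal).exists
  refine ⟨R, fun x hx => ?_⟩
  have h1 : α₁ ‖x‖₊ < α₁ R :=
    (NNReal.coe_le_coe.1 (hx.trans (Real.le_coe_toNNReal M))).trans_lt hR
  exact_mod_cast (hα.strictMono.lt_iff_lt.1 h1).le

lemma IsClassK.pos (hα : IsClassK α₁) {r : ℝ≥0} (hr : 0 < r) : 0 < α₁ r := by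
  rw [← hα.map_zero]
  exact hα.strictMono hr

/-- The margin ε/2 keeps the inequality strict after taking the supremum. -/
lemma iSup_enorm_lt_of_classK {x : ℝ → EuclideanSpace ℝ (Fin n)} (hα : IsClassK α₁) {ε : ℝ}
    (hε : 0 < ε) {A : Set ℝ}
    (h : ∀ t ∈ A, (α₁ ‖x t‖₊ : ℝ) ≤ α₁ (ε / 2).toNNReal) :
    ⨆ t ∈ A, ‖x t‖ₑ < ENNReal.ofReal ε := by
  refine lt_of_le_of_lt (iSup₂_le fun t ht => ?_)
    ((ENNReal.ofReal_lt_ofReal_iff hε).2 (half_lt_self hε))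
  have h1 : ‖x t‖₊ ≤ (ε / 2).toNNReal := hα.strictMono.le_iff_le.1 (NNReal.coe_le_coe.1 (h t ht))
  exact ENNReal.coe_le_coe.2 h1

namespace IsSwitchingSequence

/-- This one estimate yields both properties: J = 0 with M a global bound gives stability, J large
with M small gives attractivity. -/
lemma classK_le (hτ : IsSwitchingSequence s τ) (hF : ∀ i, IsDampedField (F i) (W i) (c i))
    (hW : ∀ i x, (α₁ ‖x‖₊ : ℝ) ≤ W i x ∧ W i x ≤ (α₂ ‖x‖₊ : ℝ))
    (hμ : 1 ≤ μ) (hWμ : ∀ i j x, W i x ≤ μ * W j x) {J : ℕ} {M : ℝ}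
    (hM : ∀ j, J ≤ j →
      growthFactor μ c (fun k => s (τ k)) (fun k => τ (k + 1) - τ k) j ≤ M)
    {x₀ : EuclideanSpace ℝ (Fin n)} {x : ℝ → EuclideanSpace ℝ (Fin n)}
    (hx : IsGlobalSolution F s x₀ x) {t : ℝ} (ht : τ J ≤ t) :
    (α₁ ‖x t‖₊ : ℝ) ≤ M * α₂ ‖x₀‖₊ := by
  obtain ⟨j, hJj, hj⟩ := hτ.exists_mem_Icc ht
  have hmax := max_le (hM j hJj) (hM (j + 1) (hJj.trans j.le_succ))
  have hM0 : 0 ≤ M := (Finset.prod_nonneg fun k _ => by positivity).trans (hM J le_rfl)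
  calc (α₁ ‖x t‖₊ : ℝ) ≤ W (s (τ j)) (x t) := (hW _ _).1
    _ ≤ _ := hτ.lyapunov_le hF hμ hWμ hx j hj
    _ ≤ M * W (s 0) x₀ := mul_le_mul_of_nonneg_right hmax ((hF _).nonneg _)
    _ ≤ M * α₂ ‖x₀‖₊ := mul_le_mul_of_nonneg_left (hW _ _).2 hM0

/-- Uniform stability of the switched system when the growth factors tend to zero. -/
lemma stable (hτ : IsSwitchingSequence s τ) (hF : ∀ i, IsDampedField (F i) (W i) (c i))
    (hα₁ : IsClassKInfty α₁) (hα₂ : IsClassKInfty α₂)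
    (hW : ∀ i x, (α₁ ‖x‖₊ : ℝ) ≤ W i x ∧ W i x ≤ (α₂ ‖x‖₊ : ℝ))
    (hμ : 1 ≤ μ) (hWμ : ∀ i j x, W i x ≤ μ * W j x)
    (hZ : Tendsto (growthFactor μ c (fun k => s (τ k)) (fun k => τ (k + 1) - τ k)) atTop (𝓝 0))
    {ε : ℝ} (hε : 0 < ε) : ∃ δ : ℝ, 0 < δ ∧ ∀ x₀ x, IsGlobalSolution F s x₀ x → ‖x₀‖ < δ →
      ⨆ t ∈ Ici (0 : ℝ), ‖x t‖ₑ < ENNReal.ofReal ε := by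
  obtain ⟨M, hM⟩ := hZ.bddAbove_range
  have hlim : Tendsto (fun z : EuclideanSpace ℝ (Fin n) => M * (α₂ ‖z‖₊ : ℝ)) (𝓝 0) (𝓝 0) := by
    have hc : Continuous fun z : EuclideanSpace ℝ (Fin n) => M * (α₂ ‖z‖₊ : ℝ) :=
      continuous_const.mul (NNReal.continuous_coe.comp (hα₂.continuous.comp continuous_nnnorm))
    simpa [hα₂.map_zero] using hc.tendsto 0
  have hpos : (0 : ℝ) < α₁ (ε / 2).toNNReal :=
    NNReal.coe_pos.2 (hα₁.toIsClassK.pos (Real.toNNReal_pos.2 (half_pos hε)))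
  obtain ⟨δ, hδ, hball⟩ := Metric.eventually_nhds_iff.1 (hlim.eventually_lt_const hpos)
  refine ⟨δ, hδ, fun x₀ x hx hx₀ => iSup_enorm_lt_of_classK hα₁.toIsClassK hε fun t ht => ?_⟩
  exact (hτ.classK_le (J := 0) hF hW hμ hWμ (fun j _ => hM (mem_range_self j)) hx
    (hτ.zero.trans_le ht)).trans (hball (by simpa using hx₀)).le

/-- Uniform attractivity of the switched system when the growth factors tend to zero. -/
lemma attractive (hτ : IsSwitchingSequence s τ) (hF : ∀ i, IsDampedField (F i) (W i) (c i))
    (hα₁ : IsClassKInfty α₁) (hα₂ : IsClassKInfty α₂)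
    (hW : ∀ i x, (α₁ ‖x‖₊ : ℝ) ≤ W i x ∧ W i x ≤ (α₂ ‖x‖₊ : ℝ))
    (hμ : 1 ≤ μ) (hWμ : ∀ i j x, W i x ≤ μ * W j x)
    (hZ : Tendsto (growthFactor μ c (fun k => s (τ k)) (fun k => τ (k + 1) - τ k)) atTop (𝓝 0))
    {r ε : ℝ} (hr : 0 < r) (hε : 0 < ε) : ∃ T : ℝ, 0 ≤ T ∧ ∀ x₀ x, IsGlobalSolution F s x₀ x →
      ‖x₀‖ < r → ⨆ t ∈ Ici T, ‖x t‖ₑ < ENNReal.ofReal ε := by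
  have hα₂r : (0 : ℝ) < α₂ r.toNNReal :=
    NNReal.coe_pos.2 (hα₂.toIsClassK.pos (Real.toNNReal_pos.2 hr))
  have hpos : (0 : ℝ) < α₁ (ε / 2).toNNReal :=
    NNReal.coe_pos.2 (hα₁.toIsClassK.pos (Real.toNNReal_pos.2 (half_pos hε)))
  obtain ⟨J, hJ⟩ := eventually_atTop.1 (hZ.eventually_le_const (div_pos hpos hα₂r))
  refine ⟨τ J, hτ.nonneg J, fun x₀ x hx hx₀ =>
    iSup_enorm_lt_of_classK hα₁.toIsClassK hε fun t ht => ?_⟩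
  refine (hτ.classK_le hF hW hμ hWμ hJ hx ht).trans ?_
  have h1 : (α₂ ‖x₀‖₊ : ℝ) ≤ α₂ r.toNNReal := NNReal.coe_le_coe.2 <|
    hα₂.strictMono.monotone (by rw [← norm_toNNReal]; exact Real.toNNReal_le_toNNReal hx₀.le)
  calc _ ≤ _ := mul_le_mul_of_nonneg_left h1 (div_pos hpos hα₂r).le
    _ = _ := div_mul_cancel₀ _ hα₂r.ne'

end IsSwitchingSequence

end Stability

/-! ### Almost sure behaviour of signals of class EH. -/

section Signal

variable {Ω : Type*} [MeasurableSpace Ω] {P : Measure Ω} {N : ℕ} {σ : ℝ → Ω → Fin N} {τ : ℕ → Ω → ℝ} {lam : ℝ} {q : Fin N → ℝ}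

lemma IsSwitchingInstants.measurable_holdingTime (hτ : IsSwitchingInstants P σ τ) (k : ℕ) :
    Measurable (holdingTime τ k) :=
  (hτ.measurable (k + 1)).sub (hτ.measurable k)

/-- Partial sums of i.i.d. exponential holding times tend to infinity almost surely. -/
lemma IsSwitchingInstants.ae_tendsto_atTop [IsProbabilityMeasure P]
    (hτ : IsSwitchingInstants P σ τ) (hlam : 0 < lam)
    (hind : iIndepFun (holdingTime τ) P) (hexp : ∀ i, P.map (holdingTime τ i) = expMeasure lam) :
    ∀ᵐ ω ∂P, Tendsto (fun j => τ j ω) atTop atTop := by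
  have hprod : ∀ j ω, ENNReal.ofReal (Real.exp (-τ j ω)) =
      ∏ k ∈ Finset.range j, ENNReal.ofReal (Real.exp (-1 * holdingTime τ k ω)) := by
    intro j ω
    rw [← ENNReal.ofReal_prod_of_nonneg fun k _ => (Real.exp_pos _).le, ← Real.exp_sum,
      ← Finset.mul_sum]
    simp only [holdingTime]
    rw [Finset.sum_range_sub (fun k => τ k ω), hτ.zero ω]
    congr 2
    ring
  have hρ : ENNReal.ofReal (lam / (1 + lam)) < 1 := by
    rw [ENNReal.ofReal_lt_one, div_lt_one (by linarith)]
    linarith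
  have hm : Measurable fun s : ℝ => ENNReal.ofReal (Real.exp (-1 * s)) := by fun_prop
  -- E exp(-τ_j) = (λ/(1+λ))^j, so exp(-τ_j) → 0 almost surely; this rules out accumulation of
  -- switching instants.
  have h0 := ae_tendsto_zero_of_lintegral_le_geometric (P := P)
    (Z := fun j ω => Real.exp (-τ j ω)) (c := 1) (ρ := ENNReal.ofReal (lam / (1 + lam)))
    (fun j => Real.measurable_exp.comp (hτ.measurable j).neg)
    (fun j ω => (Real.exp_pos _).le) ENNReal.one_ne_top hρ fun j => by
      simp_rw [hprod]
      rw [lintegral_prod_eq_prod_lintegral_of_indepFun _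
        (fun k ω => ENNReal.ofReal (Real.exp (-1 * holdingTime τ k ω)))
        (hind.comp _ fun _ => hm) fun k => hm.comp (hτ.measurable_holdingTime k)]
      have hk : ∀ k, ∫⁻ ω, ENNReal.ofReal (Real.exp (-1 * holdingTime τ k ω)) ∂P =
          ENNReal.ofReal (lam / (1 + lam)) := fun k => by
        rw [← lintegral_exp_neg_mul_expMeasure (c := 1) hlam (by linarith), ← hexp k,
          lintegral_map hm (hτ.measurable_holdingTime k)]
      simp only [hk, Finset.prod_const, Finset.card_range, one_mul]
      exact pow_le_pow_right_of_le_one' hρ.le j.le_succ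
  filter_upwards [h0] with ω hω
  have h1 := Real.tendsto_exp_comp_nhds_zero.1 hω
  exact (tendsto_neg_atBot_atTop.comp h1).congr fun j => neg_neg _

/-- Under the contraction-in-mean condition, the growth factors of a signal of class EH tend to
zero almost surely. -/
lemma IsSwitchingInstants.ae_tendsto_growthFactor [IsProbabilityMeasure P]
    (hτ : IsSwitchingInstants P σ τ) {σ₀ : Fin N}
    (hσ0 : ∀ ω, σ 0 ω = σ₀) (hlam : 0 < lam) (hind : iIndepFun (holdingTime τ) P)
    (hexp : ∀ i, P.map (holdingTime τ i) = expMeasure lam) (hq : ∀ i, 0 ≤ q i)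
    (hce : ∀ j, 1 ≤ j → ∀ i, P[{ω | σ (τ j ω) ω = i}.indicator (fun _ => (1 : ℝ)) |
        ⨆ k : Fin j, MeasurableSpace.comap (fun ω => σ (τ k ω) ω) inferInstance]
        =ᵐ[P] fun _ => q i)
    (hSY : IndepFun (fun ω i => holdingTime τ i ω) (fun ω j => σ (τ j ω) ω) P)
    {μ : ℝ} (hμ : 0 ≤ μ) {c : Fin N → ℝ} (hc : ∀ i, 0 < c i + lam)
    (hcontr : ∑ i, μ * q i / (1 + c i / lam) < 1) :
    ∀ᵐ ω ∂P, Tendsto (growthFactor μ c (fun k => σ (τ k ω) ω)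
      (fun k => τ (k + 1) ω - τ k ω)) atTop (𝓝 0) := by
  have hh : ∀ i, Measurable fun s : ℝ => ENNReal.ofReal (μ * Real.exp (-c i * s)) := fun i => by
    fun_prop
  have hint : ∀ i, ∫⁻ s, ENNReal.ofReal (μ * Real.exp (-c i * s)) ∂(expMeasure lam) =
      ENNReal.ofReal (μ * (lam / (c i + lam))) := fun i => by
    simp_rw [ENNReal.ofReal_mul hμ]
    rw [lintegral_const_mul _ (by fun_prop), lintegral_exp_neg_mul_expMeasure hlam (hc i)]
  -- Since E[μ e^{-λ_i S}] = μ/(1 + λ_i/λ), finite by (E3), the ratio is the sum in (E4).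
  have hρ : ∑ i, ENNReal.ofReal (q i) *
      ∫⁻ s, ENNReal.ofReal (μ * Real.exp (-c i * s)) ∂(expMeasure lam) < 1 := by
    have h1 : ∀ i, 0 ≤ q i * (μ * (lam / (c i + lam))) := fun i =>
      mul_nonneg (hq i) (mul_nonneg hμ (div_nonneg hlam.le (hc i).le))
    simp_rw [hint, ← ENNReal.ofReal_mul (hq _)]
    rw [← ENNReal.ofReal_sum_of_nonneg fun i _ => h1 i, ENNReal.ofReal_lt_one]
    convert hcontr using 2 with i
    have h2 := (hc i).ne'
    have h3 : 1 + c i / lam = (c i + lam) / lam := by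
      field_simp
      ring
    rw [h3]
    field_simp
  refine ae_tendsto_zero_of_lintegral_le_geometric
    (Z := fun j ω => growthFactor μ c (fun k => σ (τ k ω) ω) (fun k => τ (k + 1) ω - τ k ω) j)
    -- The first interval carries the deterministic mode σ₀, so its factor stays outside the
    -- geometric power.
    (c := ENNReal.ofReal (μ * (lam / (c σ₀ + lam)))) (fun j => ?_)
    (fun j ω => Finset.prod_nonneg fun k _ => by positivity) ENNReal.ofReal_ne_top hρ fun j => ?_
  · refine Finset.measurable_prod _ fun k _ => measurable_const.mul (Real.measurable_exp.comp ?_)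
    exact ((measurable_of_finite fun i => -c i).comp (hτ.measurable_mode k)).mul
      (hτ.measurable_holdingTime k)
  · rw [← hint σ₀, ← lintegral_prod_modes_times hτ.measurable_mode
      (fun ω => by rw [hτ.zero, hσ0]) hce hτ.measurable_holdingTime hind hexp hSY hh j]
    refine (lintegral_congr fun ω => ?_).le
    exact ENNReal.ofReal_prod_of_nonneg fun k _ => by positivity

end Signal

end RandomSwitching

/-! ### Assembly of the main theorem. -/

theorem mainTheorem7 {Ω : Type*} [MeasurableSpace Ω] (P : Measure Ω) [IsProbabilityMeasure P]
    {n N m : ℕ}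
    -- the control-affine family
    (f : Fin N → EuclideanSpace ℝ (Fin n) → EuclideanSpace ℝ (Fin n))
    (g : Fin N → Fin m → EuclideanSpace ℝ (Fin n) → EuclideanSpace ℝ (Fin n))
    (hf : ∀ i, ContDiff ℝ 2 (f i)) (hg : ∀ i j, ContDiff ℝ 2 (g i j))
    (hf0 : ∀ i, f i 0 = 0) (hg0 : ∀ i j, g i j 0 = 0)
    -- the switching signal, of class EH
    (σ : ℝ → Ω → Fin N) (σ₀ : Fin N) (hσ : RandomSwitching.IsSwitchingSignal σ σ₀)
    (lam : ℝ) (q : Fin N → ℝ) (hEH : RandomSwitching.IsClassEH P σ lam q)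
    -- the Lyapunov functions, with (V1) and (V3)
    (V : Fin N → EuclideanSpace ℝ (Fin n) → ℝ) (hV : ∀ i, ContDiff ℝ 2 (V i))
    (α₁ α₂ : ℝ≥0 → ℝ≥0) (hα₁ : RandomSwitching.IsClassKInfty α₁)
    (hα₂ : RandomSwitching.IsClassKInfty α₂)
    (hV1 : ∀ i x, (α₁ ‖x‖₊ : ℝ) ≤ V i x ∧ V i x ≤ (α₂ ‖x‖₊ : ℝ))
    (μ : ℝ) (hμ : 1 < μ) (hV3 : ∀ i j x, V i x ≤ μ * V j x)
    -- the control-Lyapunov inequality (the infimum may be `-∞`)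
    (rate : Fin N → ℝ)
    (hCLF : ∀ x, x ≠ 0 → ∀ i,
      (⨅ u : EuclideanSpace ℝ (Fin m),
        ((RandomSwitching.lieD (f i) (V i) x + rate i * V i x
          + ∑ j, u j * RandomSwitching.lieD (g i j) (V i) x : ℝ) : EReal)) < 0)
    -- the small-control property
    (hSCP : ∀ ε : ℝ, 0 < ε → ∃ δ : ℝ, 0 < δ ∧ ∀ x, x ≠ 0 → ‖x‖ < δ →
      ∃ u : EuclideanSpace ℝ (Fin m), ‖u‖ < ε ∧ ∀ i,
        RandomSwitching.lieD (f i) (V i) x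
          + ∑ j, u j * RandomSwitching.lieD (g i j) (V i) x ≤ -rate i * V i x)
    -- (E3) and (E4)
    (hE3 : ∀ i, 0 < rate i + lam)
    (hE4 : ∑ i, μ * q i / (1 + rate i / lam) < 1) :
    RandomSwitching.IsWellPosed P
        (RandomSwitching.closedLoop f g (RandomSwitching.universalFeedback f g V rate)) σ ∧
      RandomSwitching.IsGASas P
        (RandomSwitching.closedLoop f g (RandomSwitching.universalFeedback f g V rate)) σ := by
  obtain ⟨τ, hτ, ⟨hlam, hind, hexp⟩, ⟨hq, hce⟩, hSY⟩ := hEH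
  -- The single value ε = 1 suffices, since only a bound on the feedback near 0 is needed.
  obtain ⟨δ, hδ, hδu⟩ := hSCP 1 one_pos
  have hreg : ∀ i x, x ≠ 0 → ∑ j, RandomSwitching.lieD (g i j) (V i) x ^ 2 ≠ 0 ∨
      RandomSwitching.lieD (f i) (V i) x + rate i * V i x < 0 := fun i x hx =>
    RandomSwitching.sum_sq_ne_zero_or_neg_of_iInf_lt (hCLF x hx i)
  have hV0 : ∀ i, V i 0 = 0 := fun i => by
    have h := hV1 i 0
    simp only [nnnorm_zero, hα₁.map_zero, hα₂.map_zero, NNReal.coe_zero] at h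
    exact le_antisymm h.2 h.1
  have hF : ∀ i, RandomSwitching.IsDampedField (RandomSwitching.closedLoop f g
      (RandomSwitching.universalFeedback f g V rate) i) (V i) (rate i) := fun i =>
    { contDiffAt := fun x hx =>
        RandomSwitching.contDiffAt_closedLoop (hf i) (hg i) (hV i) (hreg i x hx)
      linear_growth := RandomSwitching.exists_norm_closedLoop_le (hf i) (hg i) (hf0 i) (hg0 i)
        (hV i) (hreg i) hδ fun x hx hxδ => by
          obtain ⟨u, hu, hui⟩ := hδu x hx hxδ
          exact ⟨u, hu, hui i⟩
      differentiable := (hV i).differentiable two_ne_zero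
      nonneg := fun x => (NNReal.coe_nonneg _).trans (hV1 i x).1
      proper := fun M => by
        obtain ⟨R, hR⟩ := hα₁.exists_le_of_le (n := n) M
        exact ⟨R, fun x hx => hR x ((hV1 i x).1.trans hx)⟩
      decay := fun x => by
        refine RandomSwitching.fderiv_closedLoop_le x ?_
        rcases ne_or_eq x 0 with hx | rfl
        · exact (hreg i x hx).imp_right le_of_lt
        · right
          simp [RandomSwitching.lieD, hf0, hV0] }
  have hae : ∀ᵐ ω ∂P, RandomSwitching.IsSwitchingSequence (fun t => σ t ω) (fun j => τ j ω) := by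
    filter_upwards [hτ.strictMono, hτ.const, hτ.ae_tendsto_atTop hlam hind hexp] with ω h1 h2 h3
    exact ⟨hτ.zero ω, h1, h3, h2⟩
  have hZ := hτ.ae_tendsto_growthFactor hσ.initial hlam hind hexp (fun i => (hq i).1) hce hSY
    (zero_le_one.trans hμ.le) hE3 hE4
  refine ⟨?_, ?_, ?_⟩
  · filter_upwards [hae] with ω hω x₀
    obtain ⟨x, hx⟩ := hω.exists_isGlobalSolution hF x₀
    exact ⟨x, hx, fun T hT y hy => hω.eqOn hF hT (hx T hT) hy⟩
  · filter_upwards [hae, hZ] with ω hω hZω ε hε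
    exact hω.stable hF hα₁ hα₂ hV1 hμ.le hV3 hZω hε
  · filter_upwards [hae, hZ] with ω hω hZω r ε hr hε
    exact hω.attractive hF hα₁ hα₂ hV1 hμ.le hV3 hZω hr hε
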